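/- Let $G$ be a finite simple graph with $n$ vertices, let $p$ be a precoloring of some of its vertices with colors from $\{1,\dots,\ell\}$, and let $k\ge 0$ be an integer. A vertex is happy under a coloring $c:V(G)\to\{1,\dots,\ell\}$ if all its neighbours have the same color as the vertex itself (so isolated vertices are happy). Maximum Happy Vertices (MHV) asks, given $(G,p,k)$, whether some coloring $c:V(G)\to\{1,\dots,\ell\}$ that extends $p$ makes at least $k$ vertices happy. A $w$-expression of $G$ is an expression $\Psi$ that builds $G$ using labels from $\{1,\dots,w\}$ by the operations: create a vertex $v$ with label $i$ (each vertex of $G$ being created exactly once); disjoint union; change all labels $i$ to $j$; add all edges between vertices of label $i$ and vertices of label $j$, where $i\ne j$. Its size $|\Psi|$ is its number of operations. Theorem. There are an algorithm and a constant $C$ such that, given $(G,p,k)$ together with $w$ and a $w$-expression $\Psi$ of $G$, the algorithm decides MHV in at most $C\cdot(\ell+1)^{C w}\cdot(n+|\Psi|)^{C}$ steps on a unit-cost random access machine with addition and subtraction; that is, in $(\ell+1)^{O(w)}\cdot n^{O(1)}$ time for expressions of size polynomial in $n$. In particular, MHV with a $w$-expression as part of the input is fixed-parameter tractable with respect to $w+\ell$: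 for some computable function $f$ and some constant $d$, the same algorithm takes at most $f(w+\ell)\cdot(n+|\Psi|)^{d}$ steps. -/

import Mathlib

/-! ### Clique-width expressions -/

/-- Expressions with labels `0, …, w - 1` (that is, `w`-expressions) over a set `V` of vertex names:
* `vertex i v` creates the vertex `v` with label `i`;
* `union Φ₁ Φ₂` is the disjoint union;
* `relabel i j Φ` changes every label `i` to `j`;
* `join i j h Φ`, for `i ≠ j`, adds all edges between vertices of label `i` and of label `j`. -/
inductive CWExpr (V : Type) (w : ℕ) : Type
  | vertex (i : Fin w) (v : V) : CWExpr V w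
  | union (Φ₁ Φ₂ : CWExpr V w) : CWExpr V w
  | relabel (i j : Fin w) (Φ : CWExpr V w) : CWExpr V w
  | join (i j : Fin w) (h : i ≠ j) (Φ : CWExpr V w) : CWExpr V w

namespace CWExpr

variable {V : Type} {w : ℕ}

/-- The vertices created by the expression, with multiplicity. -/
def leaves : CWExpr V w → List V
  | vertex _ v => [v]
  | union Φ₁ Φ₂ => Φ₁.leaves ++ Φ₂.leaves
  | relabel _ _ Φ => Φ.leaves
  | join _ _ _ Φ => Φ.leaves

/-- `Φ.HasLabel v a`: in the labelled graph expressed by `Φ`, the vertex `v` is present and has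
label `a`. -/
def HasLabel : CWExpr V w → V → Fin w → Prop
  | vertex i v => fun u a => u = v ∧ a = i
  | union Φ₁ Φ₂ => fun u a => Φ₁.HasLabel u a ∨ Φ₂.HasLabel u a
  | relabel i j Φ => fun u a => (Φ.HasLabel u a ∧ a ≠ i) ∨ (Φ.HasLabel u i ∧ a = j)
  | join _ _ _ Φ => fun u a => Φ.HasLabel u a

/-- `Φ.Adj u v`: the vertices `u` and `v` are adjacent in the graph expressed by `Φ`. -/
def Adj : CWExpr V w → V → V → Prop
  | vertex _ _ => fun _ _ => False
  | union Φ₁ Φ₂ => fun u v => Φ₁.Adj u v ∨ Φ₂.Adj u v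
  | relabel _ _ Φ => fun u v => Φ.Adj u v
  | join i j _ Φ => fun u v =>
      Φ.Adj u v ∨ (Φ.HasLabel u i ∧ Φ.HasLabel v j) ∨ (Φ.HasLabel u j ∧ Φ.HasLabel v i)

/-- `Φ` is an expression of the graph `G`. No vertex is created twice (so that all unions in `Φ`
are disjoint), every vertex of `G` is created, and the edges are those of `G`. -/
structure Expresses (Φ : CWExpr V w) (G : SimpleGraph V) : Prop where
  nodup : Φ.leaves.Nodup
  mem_leaves : ∀ v, v ∈ Φ.leaves
  adj_iff : ∀ u v, G.Adj u v ↔ Φ.Adj u v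

/-- The size `|Φ|`: the number of operators, vertex creations included. -/
def size : CWExpr V w → ℕ
  | vertex _ _ => 1
  | union Φ₁ Φ₂ => Φ₁.size + Φ₂.size + 1
  | relabel _ _ Φ => Φ.size + 1
  | join _ _ _ Φ => Φ.size + 1

/-- The postfix (reverse Polish) code of an expression, three numbers for each operator. -/
def code {n : ℕ} : CWExpr (Fin n) w → List ℕ
  | vertex i v => [0, (i : ℕ), (v : ℕ)]
  | union Φ₁ Φ₂ => Φ₁.code ++ Φ₂.code ++ [1, 0, 0]
  | relabel i j Φ => Φ.code ++ [2, (i : ℕ), (j : ℕ)]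
  | join i j _ Φ => Φ.code ++ [3, (i : ℕ), (j : ℕ)]

end CWExpr

/-! ### Maximum Happy Vertices -/

/-- A vertex is happy under the coloring `c` if all its neighbours have its color. -/
def IsHappy {V α : Type} (G : SimpleGraph V) (c : V → α) (v : V) : Prop :=
  ∀ u, G.Adj v u → c u = c v

/-- `(G, p, k)` is a yes-instance: some full coloring `c` that extends the precoloring `p`
(`p v = none` means that `v` is not precolored) makes at least `k` vertices happy. -/
def MHV {n ℓ : ℕ} (G : SimpleGraph (Fin n)) (p : Fin n → Option (Fin ℓ)) (k : ℕ) : Prop :=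
  ∃ c : Fin n → Fin ℓ, (∀ v a, p v = some a → c v = a) ∧ k ≤ {v | IsHappy G c v}.ncard

/-- An input: an instance `(G, p, k)` with `n` vertices and `ℓ` colors, together with a
`w`-expression `Ψ` of `G`. -/
structure MHVInput where
  n : ℕ
  ℓ : ℕ
  k : ℕ
  w : ℕ
  G : SimpleGraph (Fin n)
  p : Fin n → Option (Fin ℓ)
  Ψ : CWExpr (Fin n) w
  expresses : Ψ.Expresses G

namespace MHVInput

open Classical in
/-- The input as a list of numbers: `ℓ, k, n, w, |Ψ|`, then the adjacency matrix of `G` row by row,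
then the precoloring (`0` for a vertex that is not precolored, `a + 1` for color `a`), then the
code of `Ψ`. -/
noncomputable def encode (I : MHVInput) : List ℕ :=
  [I.ℓ, I.k, I.n, I.w, I.Ψ.size]
    ++ ((List.finRange I.n).flatMap fun u =>
          (List.finRange I.n).map fun v => if I.G.Adj u v then 1 else 0)
    ++ ((List.finRange I.n).map fun v => ((I.p v).elim 0 fun a => (a : ℕ) + 1))
    ++ I.Ψ.code

end MHVInput

/-! ### Random access machine programs and their running time

A random access machine with unit cost, whose only arithmetic is addition and (truncated)
subtraction, with structured control flow. -/

/-- The elementary instructions, on registers named by natural numbers; `reg r` below is the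
content of register `r`, and `mem a` that of the memory cell with address `a`. -/
inductive Instr : Type
  /-- `reg r := c` -/
  | const (r c : ℕ) : Instr
  /-- `reg r := reg a` -/
  | copy (r a : ℕ) : Instr
  /-- `reg r := reg a + reg b` -/
  | add (r a b : ℕ) : Instr
  /-- `reg r := reg a - reg b`, and `0` if this is negative -/
  | sub (r a b : ℕ) : Instr
  /-- `reg r := mem (reg a)` -/
  | load (r a : ℕ) : Instr
  /-- `mem (reg a) := reg r` -/
  | store (a r : ℕ) : Instr

/-- Programs. The tests of `cond` and `loop` ask whether register `r` is nonzero. -/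
inductive Prog : Type
  | instr (i : Instr) : Prog
  | seq (P Q : Prog) : Prog
  | cond (r : ℕ) (P Q : Prog) : Prog
  | loop (r : ℕ) (P : Prog) : Prog

/-- The configuration of the machine: the registers and the memory. -/
structure Store where
  reg : ℕ → ℕ
  mem : ℕ → ℕ

/-- The effect of one elementary instruction. -/
def Instr.apply : Instr → Store → Store
  | const r c, s => { s with reg := Function.update s.reg r c }
  | copy r a, s => { s with reg := Function.update s.reg r (s.reg a) }
  | add r a b, s => { s with reg := Function.update s.reg r (s.reg a + s.reg b) }
  | sub r a b, s => { s with reg := Function.update s.reg r (s.reg a - s.reg b) }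
  | load r a, s => { s with reg := Function.update s.reg r (s.mem (s.reg a)) }
  | store a r, s => { s with mem := Function.update s.mem (s.reg a) (s.reg r) }

/-- `Exec P s s' t`: started in configuration `s`, the program `P` halts in configuration `s'`
after exactly `t` steps; each elementary instruction and each test is one step. -/
inductive Exec : Prog → Store → Store → ℕ → Prop
  | instr (i : Instr) (s : Store) : Exec (.instr i) s (i.apply s) 1
  | seq {P Q : Prog} {s s' s'' : Store} {t t' : ℕ} :
      Exec P s s' t → Exec Q s' s'' t' → Exec (.seq P Q) s s'' (t + t')
  | cond_true {r : ℕ} {P Q : Prog} {s s' : Store} {t : ℕ} :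
      s.reg r ≠ 0 → Exec P s s' t → Exec (.cond r P Q) s s' (t + 1)
  | cond_false {r : ℕ} {P Q : Prog} {s s' : Store} {t : ℕ} :
      s.reg r = 0 → Exec Q s s' t → Exec (.cond r P Q) s s' (t + 1)
  | loop_done {r : ℕ} {P : Prog} {s : Store} :
      s.reg r = 0 → Exec (.loop r P) s s 1
  | loop_step {r : ℕ} {P : Prog} {s s' s'' : Store} {t t' : ℕ} :
      s.reg r ≠ 0 → Exec P s s' t → Exec (.loop r P) s' s'' t' →
      Exec (.loop r P) s s'' (t + t' + 1)

/-- The initial configuration: the input is in the memory cells `0, 1, 2, …`, and everything else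
is `0`. -/
def Store.init (x : List ℕ) : Store where
  reg := fun _ => 0
  mem := fun a => x.getD a 0

/-- On input `x`, the program `P` halts within `T` steps, and its answer (in register `0`) is
`1` if `A` holds and `0` otherwise. -/
def Prog.DecidesWithin (P : Prog) (x : List ℕ) (A : Prop) (T : ℕ) : Prop :=
  ∃ (s : Store) (t : ℕ), Exec P (Store.init x) s t ∧ t ≤ T ∧
    (A → s.reg 0 = 1) ∧ (¬ A → s.reg 0 = 0)

/-! The algorithm is dynamic programming over the subexpressions of `Ψ`. A state assigns to each
label an upper bound on the colors in its class and a promise bounding the colors of the neighbours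
which that class will get outside of the subexpression. Bounds lie in the flat lattice consisting of
nothing, one of `ℓ` single colors, and everything, so there are `(ℓ + 2) ^ (2 * w)` states. `best`
is the greatest number of vertices that stay happy under the promise, over all colorings obeying the
bounds; it is shifted by one so that `0` means infeasible.

Upper bounds, instead of exact color sets, keep the recurrences simple. Both parts of a union have
the same state and their counts add (`best_union`); a relabelling is one lookup (`best_relabel`). At
a join the vertices of class `i` get the whole class `j` as neighbours and conversely. So one
guesses tighter bounds for the two classes and adds each to the promise of the other class
(`best_join`). At the root all colors are allowed and nothing is promised (`best_root`).

For the running time, a program whose loops make at most `X` rounds takes at most `X` to a fixed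
power, so it suffices to bound every number that is counted to. One `X` polynomial in the number of
states and the input size serves throughout. The tables are filled in postfix order, each with its
subexpression's size, which locates the left operand of a union; `table_eq_best` identifies them
with `best`. The case `ℓ = 0` is answered at once, since `(ℓ + 1) ^ (C * w)` does not then bound the
number of states. -/

/-! ### Running times bounded by the shape of the program -/

/-- A size of programs for which a program whose loops make at most `X` rounds takes at most
`X ^ P.weight` steps. -/
def Prog.weight : Prog → ℕ
  | .instr _ => 1
  | .seq P Q => P.weight + Q.weight + 1
  | .cond _ P Q => P.weight + Q.weight + 1
  | .loop _ P => P.weight + 3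

/-- `P` leads from `s` to `s'` in at most `X ^ P.weight` steps. -/
def Runs (X : ℕ) (P : Prog) (s s' : Store) : Prop :=
  ∃ t, Exec P s s' t ∧ t ≤ X ^ P.weight

namespace Runs

variable {X : ℕ} {P Q : Prog} {s s' s'' : Store} {r : ℕ}

theorem instr (hX : 2 ≤ X) (i : Instr) (s : Store) : Runs X (.instr i) s (i.apply s) :=
  ⟨1, .instr i s, by simp only [Prog.weight, pow_one]; omega⟩

/-- For numbers at least `1` the sum is at most twice the product, and `2 ≤ X` absorbs the factor.
This is the extra `1` in the weight of `seq` and `cond`. -/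
theorem pow_add_pow_le (hX : 2 ≤ X) (a b : ℕ) : X ^ a + X ^ b ≤ X ^ (a + b + 1) := by
  have ha : 1 ≤ X ^ a := Nat.one_le_pow _ _ (by omega)
  have hb : 1 ≤ X ^ b := Nat.one_le_pow _ _ (by omega)
  calc X ^ a + X ^ b ≤ X ^ a * X ^ b + X ^ a * X ^ b := by nlinarith
    _ = X ^ a * X ^ b * 2 := by ring
    _ ≤ X ^ a * X ^ b * X := Nat.mul_le_mul_left _ hX
    _ = X ^ (a + b + 1) := by ring

theorem seq (hX : 2 ≤ X) (h : Runs X P s s') (h' : Runs X Q s' s'') :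
    Runs X (.seq P Q) s s'' := by
  obtain ⟨t, e, ht⟩ := h
  obtain ⟨t', e', ht'⟩ := h'
  exact ⟨t + t', .seq e e', (add_le_add ht ht').trans (pow_add_pow_le hX _ _)⟩

theorem cond_true (hX : 2 ≤ X) (hr : s.reg r ≠ 0) (h : Runs X P s s') :
    Runs X (.cond r P Q) s s' := by
  obtain ⟨t, e, ht⟩ := h
  exact ⟨t + 1, .cond_true hr e,
    (add_le_add ht (Nat.one_le_pow _ _ (by omega))).trans (pow_add_pow_le hX _ _)⟩

theorem cond_false (hX : 2 ≤ X) (hr : s.reg r = 0) (h : Runs X Q s s') :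
    Runs X (.cond r P Q) s s' := by
  obtain ⟨t, e, ht⟩ := h
  refine ⟨t + 1, .cond_false hr e,
    (add_le_add ht (Nat.one_le_pow Q.weight X (by omega))).trans ?_⟩
  have := add_le_add (Nat.one_le_pow P.weight X (by omega)) (le_refl (X ^ Q.weight))
  calc X ^ Q.weight + X ^ Q.weight ≤ X ^ Q.weight * X := by nlinarith
    _ = X ^ (Q.weight + 1) := by ring
    _ ≤ _ := Nat.pow_le_pow_right (by omega) (by simp only [Prog.weight]; omega)

/-- The invariant rule for loops that make `k` rounds. -/
theorem loop (hX : 2 ≤ X) (Inv : ℕ → Store → Prop) {k : ℕ} (hk : k ≤ X)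
    (step : ∀ i < k, ∀ s, Inv i s → s.reg r ≠ 0 ∧ ∃ s', Runs X P s s' ∧ Inv (i + 1) s')
    (done : ∀ s, Inv k s → s.reg r = 0) (start : Inv 0 s) :
    ∃ s', Runs X (.loop r P) s s' ∧ Inv k s' := by
  -- Induction on the number `j` of rounds that remain.
  have key : ∀ j ≤ k, ∀ s, Inv (k - j) s →
      ∃ s' t, Exec (.loop r P) s s' t ∧ t ≤ j * (X ^ P.weight + 1) + 1 ∧ Inv k s' := by
    intro j
    induction j with
    | zero => exact fun _ s hs => ⟨s, 1, .loop_done (done s hs), by omega, hs⟩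
    | succ j ih =>
      intro hj s hs
      obtain ⟨hr, s₁, ⟨t₁, e₁, ht₁⟩, h₁⟩ := step _ (by omega) s hs
      obtain ⟨s₂, t₂, e₂, ht₂, h₂⟩ := ih (by omega) s₁ (by convert h₁ using 1; omega)
      exact ⟨s₂, _, .loop_step hr e₁ e₂, by linarith, h₂⟩
  obtain ⟨s', t, e, ht, h⟩ := key k le_rfl s (by simpa using start)
  refine ⟨s', ⟨t, e, ht.trans ?_⟩, h⟩
  have h1 : 1 ≤ X ^ P.weight := Nat.one_le_pow _ _ (by omega)
  -- The total is at most three times `X ^ (P.weight + 1)`, and `3 ≤ X * X`; hence the `3` in the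
  -- weight of a loop.
  calc k * (X ^ P.weight + 1) + 1 ≤ X * (X ^ P.weight + X ^ P.weight) + X * X ^ P.weight := by
        gcongr
        nlinarith
    _ = X ^ P.weight * X * 3 := by ring
    _ ≤ X ^ P.weight * X * (X * X) := by gcongr; nlinarith
    _ = X ^ (P.weight + 3) := by ring

end Runs

/-! ### Terms

A term is a family of programs: `t d` leaves the registers below `d` as they are and puts a value
into register `d`. -/

/-- Programs that evaluate to a number, given the first register that they may overwrite. -/
def Tm : Type := ℕ → Prog

/-- A register context: what is known about the registers below `depth`. -/
structure Ctx where
  depth : ℕ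
  val : ℕ → ℕ

/-- `Γ'` knows all that `Γ` knows. -/
def Ctx.Le (Γ Γ' : Ctx) : Prop := Γ.depth ≤ Γ'.depth ∧ ∀ r < Γ.depth, Γ'.val r = Γ.val r

theorem Ctx.Le.refl (Γ : Ctx) : Γ.Le Γ := ⟨le_rfl, fun _ _ => rfl⟩

theorem Ctx.Le.trans {Γ Γ' Γ'' : Ctx} (h : Γ.Le Γ') (h' : Γ'.Le Γ'') : Γ.Le Γ'' :=
  ⟨h.1.trans h'.1, fun r hr => (h'.2 r (hr.trans_le h.1)).trans (h.2 r hr)⟩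

/-- In the context `Γ` and with memory `m`, the term `t` has the value `v`, and its evaluation
runs no loop for more than `X` rounds. -/
def Den (X : ℕ) (m : ℕ → ℕ) (Γ : Ctx) (t : Tm) (v : ℕ) : Prop :=
  ∀ d, Γ.depth ≤ d → ∀ s : Store, s.mem = m → (∀ r < Γ.depth, s.reg r = Γ.val r) →
    ∃ s', Runs X (t d) s s' ∧ s'.mem = m ∧ (∀ r < d, s'.reg r = s.reg r) ∧ s'.reg d = v

namespace Tm

def lit (c : ℕ) : Tm := fun d => .instr (.const d c)

def reg (r : ℕ) : Tm := fun d => .instr (.copy d r)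

def add (a b : Tm) : Tm := fun d => .seq (a d) (.seq (b (d + 1)) (.instr (.add d d (d + 1))))

def sub (a b : Tm) : Tm := fun d => .seq (a d) (.seq (b (d + 1)) (.instr (.sub d d (d + 1))))

def load (a : Tm) : Tm := fun d => .seq (a d) (.instr (.load d d))

/-- `a` if `c` is nonzero, and `b` otherwise. -/
def ite (c a b : Tm) : Tm := fun d => .seq (c d) (.cond d (a d) (b d))

/-- Iteration: `acc := init; for i = 0, …, n - 1 do acc := body i acc`. -/
def iter (n init : Tm) (body : Tm → Tm → Tm) : Tm := fun d =>
  -- Register `d` counts down, `d + 1` accumulates, `d + 2` holds `i`, and from `d + 3` on there is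
  -- scratch space.
  .seq (n d) <| .seq (init (d + 1)) <| .seq (.instr (.const (d + 2) 0)) <|
    .seq (.loop d <| .seq (body (reg (d + 2)) (reg (d + 1)) (d + 3)) <|
      .seq (.instr (.copy (d + 1) (d + 3))) <| .seq (.instr (.const (d + 3) 1)) <|
        .seq (.instr (.add (d + 2) (d + 2) (d + 3))) (.instr (.sub d d (d + 3)))) <|
      .instr (.copy d (d + 1))

/-- Subtraction is truncated, so the two differences sum to zero exactly when the values agree; the
nonzero branch is therefore `e`. -/
def ifEq (a b t e : Tm) : Tm := ite (add (sub a b) (sub b a)) e t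

def mul (a b : Tm) : Tm := iter b (lit 0) fun _ acc => add acc a

def pow (a b : Tm) : Tm := iter b (lit 1) fun _ acc => mul acc a

def max (a b : Tm) : Tm := ite (sub a b) a b

/-- The maximum of `f i` for `i < n`. -/
def bmax (n : Tm) (f : Tm → Tm) : Tm := iter n (lit 0) fun i acc => max acc (f i)

/-- The sum of `f i` for `i < n`. -/
def bsum (n : Tm) (f : Tm → Tm) : Tm := iter n (lit 0) fun i acc => add acc (f i)

/-- The quotient, found by counting the multiples of `b` as one passes the numbers up to `a`. -/
def div (a b : Tm) : Tm :=
  iter a (lit 0) fun _ acc => ite (sub (mul b (add acc (lit 1))) a) acc (add acc (lit 1))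

def mod (a b : Tm) : Tm := sub a (mul b (div a b))

end Tm

/-! ### Evaluation rules for terms -/

namespace Den

variable {X : ℕ} {m : ℕ → ℕ} {Γ Γ' : Ctx} {a b c t e : Tm} {va vb vc vt ve v : ℕ}

theorem mono (h : Den X m Γ t v) (hΓ : Γ.Le Γ') : Den X m Γ' t v := fun d hd s hm hs =>
  h d (hΓ.1.trans hd) s hm fun r hr => (hs r (hr.trans_le hΓ.1)).trans (hΓ.2 r hr)

theorem of_eq (h : Den X m Γ t v) (hv : v = va) : Den X m Γ t va := hv ▸ h

theorem lit (hX : 2 ≤ X) (c : ℕ) : Den X m Γ (.lit c) c := fun d _ s hm _ =>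
  ⟨_, .instr hX _ s, hm, fun r hr => by simp [Instr.apply, hr.ne], by simp [Instr.apply]⟩

theorem reg (hX : 2 ≤ X) {r : ℕ} (hr : r < Γ.depth) : Den X m Γ (.reg r) (Γ.val r) :=
  fun d _ s hm hs => ⟨_, .instr hX _ s, hm, fun r hr => by simp [Instr.apply, hr.ne],
    by simp [Instr.apply, hs r hr]⟩

theorem load (hX : 2 ≤ X) (ha : Den X m Γ a va) : Den X m Γ (.load a) (m va) := by
  intro d hd s hm hs
  obtain ⟨s₁, e₁, m₁, f₁, v₁⟩ := ha d hd s hm hs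
  exact ⟨_, e₁.seq hX (.instr hX _ s₁), m₁,
    fun r hr => by simp [Instr.apply, hr.ne, f₁ r hr], by simp [Instr.apply, v₁, m₁]⟩

/-- Evaluation of two terms in succession. -/
theorem pair (ha : Den X m Γ a va) (hb : Den X m Γ b vb) {d : ℕ}
    (hd : Γ.depth ≤ d) {s : Store} (hm : s.mem = m) (hs : ∀ r < Γ.depth, s.reg r = Γ.val r) :
    ∃ s₁ s₂, Runs X (a d) s s₁ ∧ Runs X (b (d + 1)) s₁ s₂ ∧ s₂.mem = m ∧
      (∀ r < d, s₂.reg r = s.reg r) ∧ s₂.reg d = va ∧ s₂.reg (d + 1) = vb := by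
  obtain ⟨s₁, e₁, m₁, f₁, v₁⟩ := ha d hd s hm hs
  obtain ⟨s₂, e₂, m₂, f₂, v₂⟩ := hb (d + 1) (by omega) s₁ m₁
    fun r hr => (f₁ r (by omega)).trans (hs r hr)
  exact ⟨s₁, s₂, e₁, e₂, m₂, fun r hr => (f₂ r (by omega)).trans (f₁ r hr),
    (f₂ d (by omega)).trans v₁, v₂⟩

theorem add (hX : 2 ≤ X) (ha : Den X m Γ a va) (hb : Den X m Γ b vb) :
    Den X m Γ (.add a b) (va + vb) := by
  intro d hd s hm hs
  obtain ⟨s₁, s₂, e₁, e₂, m₂, f₂, v₁, v₂⟩ := pair ha hb hd hm hs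
  exact ⟨_, e₁.seq hX (e₂.seq hX (.instr hX _ s₂)), m₂,
    fun r hr => by simp [Instr.apply, hr.ne, f₂ r hr], by simp [Instr.apply, v₁, v₂]⟩

theorem sub (hX : 2 ≤ X) (ha : Den X m Γ a va) (hb : Den X m Γ b vb) :
    Den X m Γ (.sub a b) (va - vb) := by
  intro d hd s hm hs
  obtain ⟨s₁, s₂, e₁, e₂, m₂, f₂, v₁, v₂⟩ := pair ha hb hd hm hs
  exact ⟨_, e₁.seq hX (e₂.seq hX (.instr hX _ s₂)), m₂,
    fun r hr => by simp [Instr.apply, hr.ne, f₂ r hr], by simp [Instr.apply, v₁, v₂]⟩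

theorem ite (hX : 2 ≤ X) (hc : Den X m Γ c vc) (ha : vc ≠ 0 → Den X m Γ a v)
    (hb : vc = 0 → Den X m Γ b v) : Den X m Γ (.ite c a b) v := by
  intro d hd s hm hs
  obtain ⟨s₁, e₁, m₁, f₁, v₁⟩ := hc d hd s hm hs
  have hs₁ : ∀ r < Γ.depth, s₁.reg r = Γ.val r := fun r hr =>
    (f₁ r (by omega)).trans (hs r hr)
  by_cases h : vc = 0
  · obtain ⟨s₂, e₂, m₂, f₂, v₂⟩ := hb h d hd s₁ m₁ hs₁
    exact ⟨s₂, e₁.seq hX (.cond_false hX (v₁.trans h) e₂), m₂,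
      fun r hr => (f₂ r hr).trans (f₁ r hr), v₂⟩
  · obtain ⟨s₂, e₂, m₂, f₂, v₂⟩ := ha h d hd s₁ m₁ hs₁
    exact ⟨s₂, e₁.seq hX (.cond_true hX (v₁.trans_ne h) e₂), m₂,
      fun r hr => (f₂ r hr).trans (f₁ r hr), v₂⟩

/-- `F` lists the values of the accumulator. The body is treated in every larger context and for all
terms denoting index and accumulator, so that iterations can be nested with the outer counters as
known registers. -/
theorem iter (hX : 2 ≤ X) {n init : Tm} {body : Tm → Tm → Tm} {N : ℕ} (F : ℕ → ℕ)
    (hn : Den X m Γ n N) (hN : N ≤ X) (hi : Den X m Γ init (F 0))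
    (hb : ∀ i < N, ∀ Γ', Γ.Le Γ' → ∀ ti ta, Den X m Γ' ti i → Den X m Γ' ta (F i) →
      Den X m Γ' (body ti ta) (F (i + 1))) :
    Den X m Γ (.iter n init body) (F N) := by
  intro d hd s hm hs
  obtain ⟨s₁, s₂, e₁, e₂, m₂, f₂, v₁, v₂⟩ := pair hn hi hd hm hs
  obtain ⟨s₃, e₃, h₃⟩ := Runs.loop (X := X) (r := d)
    (P := .seq (body (.reg (d + 2)) (.reg (d + 1)) (d + 3)) <|
      .seq (.instr (.copy (d + 1) (d + 3))) <| .seq (.instr (.const (d + 3) 1)) <|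
        .seq (.instr (.add (d + 2) (d + 2) (d + 3))) (.instr (.sub d d (d + 3))))
    (s := (Instr.const (d + 2) 0).apply s₂) hX
    (fun i s' => s'.mem = m ∧ (∀ r < d, s'.reg r = s.reg r) ∧ s'.reg d = N - i ∧
      s'.reg (d + 1) = F i ∧ s'.reg (d + 2) = i) hN
    (by
      rintro i hi' s₄ ⟨m₄, f₄, c₄, a₄, i₄⟩
      refine ⟨by omega, ?_⟩
      have hle : Γ.Le ⟨d + 3, s₄.reg⟩ :=
        ⟨by simp only; omega, fun r hr => (f₄ r (by omega)).trans (hs r hr)⟩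
      obtain ⟨s₅, e₅, m₅, f₅, v₅⟩ := hb i hi' ⟨d + 3, s₄.reg⟩ hle (.reg (d + 2)) (.reg (d + 1))
        ((reg hX (by simp)).of_eq i₄) ((reg hX (by simp)).of_eq a₄) (d + 3) le_rfl s₄ m₄
        (fun _ _ => rfl)
      refine ⟨_, e₅.seq hX ((Runs.instr hX _ _).seq hX ((Runs.instr hX _ _).seq hX
        ((Runs.instr hX _ _).seq hX (Runs.instr hX _ _)))), m₅, fun r hr => ?_, ?_, ?_, ?_⟩
      · have h1 : r ≠ d := by omega
        have h2 : r ≠ d + 1 := by omega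
        have h3 : r ≠ d + 2 := by omega
        have h4 : r ≠ d + 3 := by omega
        simp [Instr.apply, h1, h2, h3, h4, f₅ r (by omega), f₄ r hr]
      · have := f₅ d (by omega)
        simp [Instr.apply, this, c₄]
        omega
      · simp [Instr.apply, v₅]
      · have := f₅ (d + 2) (by omega)
        simp [Instr.apply, this, i₄])
    (by rintro s₄ ⟨-, -, c₄, -⟩; omega)
    ⟨m₂, fun r hr => by simp [Instr.apply, f₂ r hr, show r ≠ d + 2 by omega],
      by simp [Instr.apply, v₁], by simp [Instr.apply, v₂], by simp [Instr.apply]⟩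
  exact ⟨_, e₁.seq hX (e₂.seq hX ((Runs.instr hX _ _).seq hX (e₃.seq hX (Runs.instr hX _ _)))),
    h₃.1, fun r hr => by simp [Instr.apply, hr.ne, h₃.2.1 r hr], by
      simp [Instr.apply, h₃.2.2.2.1]⟩

theorem ifEq (hX : 2 ≤ X) (ha : Den X m Γ a va) (hb : Den X m Γ b vb)
    (ht : va = vb → Den X m Γ t vt) (he : va ≠ vb → Den X m Γ e ve) :
    Den X m Γ (.ifEq a b t e) (if va = vb then vt else ve) := by
  refine ite hX (add hX (sub hX ha hb) (sub hX hb ha)) (fun h => ?_) fun h => ?_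
  · have h : va ≠ vb := by omega
    simpa [h] using he h
  · have h : va = vb := by omega
    simpa [h] using ht h

theorem max (hX : 2 ≤ X) (ha : Den X m Γ a va) (hb : Den X m Γ b vb) :
    Den X m Γ (.max a b) (va ⊔ vb) :=
  ite hX (sub hX ha hb) (fun h => ha.of_eq (sup_eq_left.2 (by omega)).symm)
    fun h => hb.of_eq (sup_eq_right.2 (by omega)).symm

theorem bmax (hX : 2 ≤ X) {n : Tm} {f : Tm → Tm} {N : ℕ} {F : ℕ → ℕ} (hn : Den X m Γ n N)
    (hN : N ≤ X)
    (hf : ∀ i < N, ∀ Γ', Γ.Le Γ' → ∀ ti, Den X m Γ' ti i → Den X m Γ' (f ti) (F i)) :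
    Den X m Γ (.bmax n f) ((Finset.range N).sup F) :=
  iter hX (fun i => (Finset.range i).sup F) hn hN (lit hX 0) fun i hi Γ' hΓ ti _ hti hta =>
    (max hX hta (hf i hi Γ' hΓ ti hti)).of_eq
      (by rw [Finset.range_add_one, Finset.sup_insert, sup_comm])

theorem bsum (hX : 2 ≤ X) {n : Tm} {f : Tm → Tm} {N : ℕ} {F : ℕ → ℕ} (hn : Den X m Γ n N)
    (hN : N ≤ X)
    (hf : ∀ i < N, ∀ Γ', Γ.Le Γ' → ∀ ti, Den X m Γ' ti i → Den X m Γ' (f ti) (F i)) :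
    Den X m Γ (.bsum n f) (∑ i ∈ Finset.range N, F i) :=
  iter hX (fun i => ∑ i ∈ Finset.range i, F i) hn hN (lit hX 0) fun i hi Γ' hΓ ti _ hti hta =>
    (add hX hta (hf i hi Γ' hΓ ti hti)).of_eq (Finset.sum_range_succ F i).symm

theorem mul (hX : 2 ≤ X) (ha : Den X m Γ a va) (hb : Den X m Γ b vb) (h : vb ≤ X) :
    Den X m Γ (.mul a b) (va * vb) :=
  iter hX (fun i => va * i) hb h (lit hX 0) fun _ _ _ hΓ _ _ _ hta => add hX hta (ha.mono hΓ)

/-- Each multiplication loops over the factor `va`, never over the accumulated power, so the power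
itself need not be below `X`. -/
theorem pow (hX : 2 ≤ X) (ha : Den X m Γ a va) (hb : Den X m Γ b vb) (hva : va ≤ X)
    (hvb : vb ≤ X) : Den X m Γ (.pow a b) (va ^ vb) :=
  (iter hX (fun i => va ^ i) hb hvb (lit hX 1) fun i _ _ hΓ _ _ _ hta =>
    (mul hX hta (ha.mono hΓ) hva).of_eq (pow_succ va i).symm)

/-- After `i` rounds the accumulator is the minimum of the quotient and `i`; `va` rounds suffice
because the quotient is at most `va`. -/
theorem div (hX : 2 ≤ X) (ha : Den X m Γ a va) (hb : Den X m Γ b vb) (hva : va ≤ X)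
    (hvb : 0 < vb) : Den X m Γ (.div a b) (va / vb) := by
  have key : ∀ i, va / vb ⊓ i + 1 ≤ va / vb ↔ vb * (va / vb ⊓ i + 1) ≤ va := fun i => by
    rw [Nat.le_div_iff_mul_le hvb, mul_comm]
  refine (iter hX (fun i => va / vb ⊓ i) ha hva ((lit hX 0).of_eq (by simp))
    fun i hi Γ' hΓ _ ta _ hta => ?_).of_eq (inf_eq_left.2 (Nat.div_le_self va vb))
  have hta' := add hX hta (lit hX 1)
  have hle : va / vb ⊓ i + 1 ≤ X := by
    have : va / vb ⊓ i ≤ i := inf_le_right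
    omega
  refine ite hX (sub hX (mul hX (hb.mono hΓ) hta' hle) (ha.mono hΓ)) (fun h => hta.of_eq ?_)
    fun h => hta'.of_eq ?_
  · have := (key i).not.2 (by omega)
    omega
  · have := (key i).2 (by omega)
    omega

theorem mod (hX : 2 ≤ X) (ha : Den X m Γ a va) (hb : Den X m Γ b vb) (hva : va ≤ X)
    (hvb : 0 < vb) : Den X m Γ (.mod a b) (va % vb) :=
  (sub hX ha (mul hX hb (div hX ha hb hva hvb) ((Nat.div_le_self va vb).trans hva))).of_eq
    (Nat.mod_eq_sub_mul_div).symm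

end Den

/-! ### Filling a block of memory -/

/-- `mem (base + y) := f y` for `y = 0, …, n - 1`. -/
def fill (n base : Tm) (f : Tm → Tm) : Prog :=
  .seq (n 0) <| .seq (base 1) <| .seq (.instr (.const 2 0)) <|
    .loop 0 <| .seq (f (.reg 2) 3) <| .seq (.instr (.add 4 1 2)) <|
      .seq (.instr (.store 4 3)) <| .seq (.instr (.const 3 1)) <|
        .seq (.instr (.add 2 2 3)) (.instr (.sub 0 0 3))

/-- The memory after the first `y` rounds of `fill`. -/
def fillMem (base : ℕ) (F : (ℕ → ℕ) → ℕ → ℕ) (m : ℕ → ℕ) : ℕ → ℕ → ℕ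
  | 0 => m
  | y + 1 => Function.update (fillMem base F m y) (base + y) (F (fillMem base F m y) y)

/-- The value of a cell is computed in the memory left by the preceding rounds, which is why `F`
takes a memory: later cells may depend on earlier ones. -/
theorem Runs.fill {X : ℕ} (hX : 2 ≤ X) {n base : Tm} {f : Tm → Tm} {N b : ℕ}
    {F : (ℕ → ℕ) → ℕ → ℕ} {s : Store} (hn : ∀ Γ, Den X s.mem Γ n N)
    (hb : ∀ Γ, Den X s.mem Γ base b) (hN : N ≤ X)
    (hf : ∀ y < N, ∀ Γ t, Den X (fillMem b F s.mem y) Γ t y →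
      Den X (fillMem b F s.mem y) Γ (f t) (F (fillMem b F s.mem y) y)) :
    ∃ s', Runs X (fill n base f) s s' ∧ s'.mem = fillMem b F s.mem N := by
  obtain ⟨s₁, s₂, e₁, e₂, m₂, -, v₁, v₂⟩ :=
    Den.pair (hn ⟨0, s.reg⟩) (hb _) (d := 0) le_rfl rfl (fun _ _ => rfl)
  obtain ⟨s₃, e₃, h₃⟩ := Runs.loop (X := X) (r := 0)
    (P := .seq (f (.reg 2) 3) <| .seq (.instr (.add 4 1 2)) <|
      .seq (.instr (.store 4 3)) <| .seq (.instr (.const 3 1)) <|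
        .seq (.instr (.add 2 2 3)) (.instr (.sub 0 0 3)))
    (s := (Instr.const 2 0).apply s₂) hX
    (fun y s' => s'.mem = fillMem b F s.mem y ∧ s'.reg 0 = N - y ∧ s'.reg 1 = b ∧ s'.reg 2 = y)
    hN
    (by
      rintro y hy s₄ ⟨m₄, c₄, b₄, y₄⟩
      refine ⟨by omega, ?_⟩
      obtain ⟨s₅, e₅, m₅, f₅, v₅⟩ := hf y hy ⟨3, s₄.reg⟩ (.reg 2)
        ((Den.reg hX (by simp)).of_eq y₄) 3 le_rfl s₄ m₄ (fun _ _ => rfl)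
      refine ⟨_, e₅.seq hX ((Runs.instr hX _ _).seq hX ((Runs.instr hX _ _).seq hX
        ((Runs.instr hX _ _).seq hX ((Runs.instr hX _ _).seq hX (Runs.instr hX _ _))))), ?_⟩
      have f0 := f₅ 0 (by omega)
      have f1 := f₅ 1 (by omega)
      have f2 := f₅ 2 (by omega)
      simp [Instr.apply, fillMem, f0, f1, f2, c₄, b₄, y₄, m₅, v₅]
      omega)
    (by rintro s₄ ⟨-, c₄, -⟩; omega)
    ⟨m₂, by simp [Instr.apply, v₁], by simpa [Instr.apply] using v₂, by simp [Instr.apply]⟩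
  exact ⟨s₃, e₁.seq hX (e₂.seq hX ((Runs.instr hX _ _).seq hX e₃)), h₃.1⟩

/-- Cells are written in increasing order, each once, so a cell below `base + y` is final after `y`
rounds. -/
theorem fillMem_of_lt (base : ℕ) (F : (ℕ → ℕ) → ℕ → ℕ) (m : ℕ → ℕ) {y z a : ℕ} (hyz : y ≤ z)
    (ha : a < base + y) : fillMem base F m z a = fillMem base F m y a := by
  induction z, hyz using Nat.le_induction with
  | base => rfl
  | succ z hz ih => rw [fillMem, Function.update_of_ne (by omega), ih]

theorem fillMem_add (base : ℕ) (F : (ℕ → ℕ) → ℕ → ℕ) (m : ℕ → ℕ) {y z : ℕ} (hyz : y < z) :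
    fillMem base F m z (base + y) = F (fillMem base F m y) y := by
  rw [fillMem_of_lt base F m (Nat.succ_le_of_lt hyz) (by omega), fillMem, Function.update_self]

/-! ### The dynamic program

The label classes are described by the numbers `0` (no color), `1, …, ℓ` (at most the color `0`,
…, `ℓ - 1`) and `ℓ + 1` (any colors). A state `σ` gives, for each label `a < w`, such an upper
bound `σ a` on the colors in the class of `a`, and one, `σ (w + a)`, on the colors of the neighbours
that the vertices in the class of `a` will get outside of the expression. -/

/-- The least upper bound of two color descriptions. -/
def lub (ℓ x y : ℕ) : ℕ := if x = 0 then y else if y = 0 then x else if x = y then x else ℓ + 1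

/-- The equation expresses the order of the flat lattice with bottom `0` and top `ℓ + 1`. -/
theorem lub_eq_right_iff {ℓ x y : ℕ} : lub ℓ x y = y ↔ x = 0 ∨ x = y ∨ y = ℓ + 1 := by
  unfold lub; split_ifs <;> omega

theorem lub_eq_zero_or_iff {ℓ x y c : ℕ} (hc : c < ℓ) :
    (lub ℓ x y = 0 ∨ lub ℓ x y = c + 1) ↔ (x = 0 ∨ x = c + 1) ∧ (y = 0 ∨ y = c + 1) := by
  unfold lub; split_ifs <;> grind

theorem lub_lt {ℓ x y : ℕ} (hx : x < ℓ + 2) (hy : y < ℓ + 2) : lub ℓ x y < ℓ + 2 := by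
  unfold lub; split_ifs <;> omega

/-- The state before the relabelling: the class of `i` is about to enter that of `j`, so it inherits
both bounds of `j`. -/
def relabelState (w i j : ℕ) (σ : ℕ → ℕ) (k : ℕ) : ℕ :=
  if k = i then σ j else if k = w + i then σ (w + j) else σ k

/-- The state before the join: `s` and `t` are guessed bounds for the classes of `i` and `j`, and
each is added to the promise of the other class. -/
def joinState (ℓ w i j s t : ℕ) (σ : ℕ → ℕ) (k : ℕ) : ℕ :=
  if k = i then s else if k = j then t else
    if k = w + i then lub ℓ (σ (w + i)) t else if k = w + j then lub ℓ (σ (w + j)) s else σ k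

theorem relabelState_lt {q w i j : ℕ} {σ : ℕ → ℕ} (hσ : ∀ k, σ k < q) (k : ℕ) :
    relabelState w i j σ k < q := by
  unfold relabelState
  split_ifs <;> exact hσ _

theorem joinState_lt {ℓ w i j s t : ℕ} {σ : ℕ → ℕ} (hσ : ∀ k, σ k < ℓ + 2) (hs : s < ℓ + 2)
    (ht : t < ℓ + 2) (k : ℕ) : joinState ℓ w i j s t σ k < ℓ + 2 := by
  unfold joinState
  split_ifs
  exacts [hs, ht, lub_lt (hσ _) ht, lub_lt (hσ _) hs, hσ k]

/-- Here `s` bounds the color, `t` is the promise and `p` the encoded precolor. With the shift by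
one, `2` means a happy vertex, `1` an unhappy one, `0` infeasibility. -/
def vertexEntry (ℓ s t p : ℕ) : ℕ :=
  (Finset.range ℓ).sup fun c =>
    if (s = c + 1 ∨ s = ℓ + 1) ∧ (p = 0 ∨ p = c + 1) then
      if t = 0 ∨ t = c + 1 then 2 else 1
    else 0

/-- Both summands carry the shift by one, so one of the two is removed. -/
def unionEntry (x y : ℕ) : ℕ := if x = 0 then 0 else if y = 0 then 0 else x + y - 1

def joinEntry (ℓ w i j : ℕ) (σ : ℕ → ℕ) (g : (ℕ → ℕ) → ℕ) : ℕ :=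
  (Finset.range (ℓ + 2)).sup fun s => (Finset.range (ℓ + 2)).sup fun t =>
    if lub ℓ s (σ i) = σ i then
      if lub ℓ t (σ j) = σ j then g (joinState ℓ w i j s t σ) else 0
    else 0

/-! ### Labels and leaves of expressions -/

namespace CWExpr

theorem HasLabel.mem_leaves {V : Type} {w : ℕ} {Φ : CWExpr V w} {v : V} {a : Fin w}
    (h : Φ.HasLabel v a) : v ∈ Φ.leaves := by
  induction Φ generalizing a with
  | vertex i u => simpa [leaves] using h.1
  | union Φ₁ Φ₂ ih₁ ih₂ =>
    simp only [leaves, List.mem_append]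
    exact h.imp ih₁ ih₂
  | relabel i j Φ ih => exact h.elim (fun h => ih h.1) fun h => ih h.1
  | join i j hij Φ ih => exact ih h

theorem exists_hasLabel {V : Type} {w : ℕ} {Φ : CWExpr V w} {v : V} (h : v ∈ Φ.leaves) :
    ∃ a, Φ.HasLabel v a := by
  induction Φ with
  | vertex i u => exact ⟨i, by simpa [leaves] using h, rfl⟩
  | union Φ₁ Φ₂ ih₁ ih₂ =>
    rcases List.mem_append.1 h with h | h
    · exact (ih₁ h).imp fun _ => Or.inl
    · exact (ih₂ h).imp fun _ => Or.inr
  | relabel i j Φ ih =>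
    obtain ⟨a, ha⟩ := ih h
    by_cases hai : a = i
    · exact ⟨j, .inr ⟨hai ▸ ha, rfl⟩⟩
    · exact ⟨a, .inl ⟨ha, hai⟩⟩
  | join i j hij Φ ih => exact ih h

theorem HasLabel.unique {V : Type} {w : ℕ} {Φ : CWExpr V w} (hΦ : Φ.leaves.Nodup) {v : V}
    {a b : Fin w} (ha : Φ.HasLabel v a) (hb : Φ.HasLabel v b) : a = b := by
  induction Φ generalizing a b with
  | vertex i u => exact ha.2.trans hb.2.symm
  | union Φ₁ Φ₂ ih₁ ih₂ =>
    obtain ⟨h₁, h₂, h⟩ := List.nodup_append'.1 hΦ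
    rcases ha with ha | ha <;> rcases hb with hb | hb
    · exact ih₁ h₁ ha hb
    · exact (h ha.mem_leaves hb.mem_leaves).elim
    · exact (h hb.mem_leaves ha.mem_leaves).elim
    · exact ih₂ h₂ ha hb
  | relabel i j Φ ih =>
    rcases ha with ⟨ha, ha'⟩ | ⟨ha, rfl⟩ <;> rcases hb with ⟨hb, hb'⟩ | ⟨hb, rfl⟩
    · exact ih hΦ ha hb
    · exact (ha' (ih hΦ ha hb)).elim
    · exact (hb' (ih hΦ hb ha)).elim
    · rfl
  | join i j hij Φ ih => exact ih hΦ ha hb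

theorem Adj.mem_leaves {V : Type} {w : ℕ} {Φ : CWExpr V w} {u v : V} (h : Φ.Adj u v) :
    u ∈ Φ.leaves ∧ v ∈ Φ.leaves := by
  induction Φ with
  | vertex i u => exact h.elim
  | union Φ₁ Φ₂ ih₁ ih₂ =>
    simp only [leaves, List.mem_append]
    exact h.elim (fun h => ⟨.inl (ih₁ h).1, .inl (ih₁ h).2⟩)
      fun h => ⟨.inr (ih₂ h).1, .inr (ih₂ h).2⟩
  | relabel i j Φ ih => exact ih h
  | join i j hij Φ ih =>
    rcases h with h | h | h
    · exact ih h
    · exact ⟨h.1.mem_leaves, h.2.mem_leaves⟩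
    · exact ⟨h.1.mem_leaves, h.2.mem_leaves⟩

/-! ### Best values and their recurrences -/

variable {n ℓ w : ℕ}

/-- The coloring `c` of the vertices of `Φ` extends `p` and obeys the bounds in `σ`. -/
def Valid (Φ : CWExpr (Fin n) w) (p : Fin n → Option (Fin ℓ)) (σ : ℕ → ℕ) (c : Fin n → Fin ℓ) :
    Prop :=
  ∀ v a, Φ.HasLabel v a → (σ a = c v + 1 ∨ σ a = ℓ + 1) ∧ ∀ x, p v = some x → c v = x

/-- The vertex `v` of `Φ` is happy, now and when it gets the neighbours announced in `σ`. -/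
def StaysHappy (Φ : CWExpr (Fin n) w) (σ : ℕ → ℕ) (c : Fin n → Fin ℓ) (v : Fin n) : Prop :=
  (∃ a, Φ.HasLabel v a ∧ (σ (w + a) = 0 ∨ σ (w + a) = c v + 1)) ∧ ∀ u, Φ.Adj v u → c u = c v

noncomputable def happyCount (Φ : CWExpr (Fin n) w) (σ : ℕ → ℕ) (c : Fin n → Fin ℓ) : ℕ :=
  {v | Φ.StaysHappy σ c v}.ncard

open Classical in
/-- One more than the greatest number of happy vertices, or `0` if no coloring is valid. -/
noncomputable def best (Φ : CWExpr (Fin n) w) (p : Fin n → Option (Fin ℓ)) (σ : ℕ → ℕ) : ℕ :=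
  Finset.univ.sup fun c : Fin n → Fin ℓ => if Φ.Valid p σ c then Φ.happyCount σ c + 1 else 0

variable {Φ Φ₁ Φ₂ : CWExpr (Fin n) w} {p : Fin n → Option (Fin ℓ)} {σ τ : ℕ → ℕ}
  {c c' : Fin n → Fin ℓ} {r : ℕ}

theorem Valid.le_best (h : Φ.Valid p σ c) : Φ.happyCount σ c + 1 ≤ Φ.best p σ := by
  unfold best
  exact le_trans (by rw [if_pos h]) (Finset.le_sup (Finset.mem_univ c))

theorem best_le (h : ∀ c : Fin n → Fin ℓ, Φ.Valid p σ c → Φ.happyCount σ c + 1 ≤ r) :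
    Φ.best p σ ≤ r := by
  classical
  refine Finset.sup_le fun c _ => ?_
  split_ifs with hc
  · exact h c hc
  · exact Nat.zero_le r

theorem exists_best (h : Φ.best p σ ≠ 0) :
    ∃ c : Fin n → Fin ℓ, Φ.Valid p σ c ∧ Φ.best p σ = Φ.happyCount σ c + 1 := by
  by_contra! hc
  have : Φ.best p σ ≤ Φ.best p σ - 1 := best_le fun c hv => by
    have := hv.le_best
    have := hc c hv
    omega
  omega

/-- Only the first `2 * w` values of a state and the colors on the leaves matter. This permits the
gluing of colorings at a union and the replacement of a state by its digits. -/
theorem Valid.congr (hσ : ∀ k < w + w, σ k = τ k) (hc : ∀ v ∈ Φ.leaves, c v = c' v)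
    (h : Φ.Valid p σ c) : Φ.Valid p τ c' := fun v a hva => by
  rw [← hσ a (by omega), ← hc v hva.mem_leaves]
  exact h v a hva

theorem StaysHappy.congr (hσ : ∀ k < w + w, σ k = τ k) (hc : ∀ v ∈ Φ.leaves, c v = c' v)
    {v : Fin n} (h : Φ.StaysHappy σ c v) : Φ.StaysHappy τ c' v := by
  obtain ⟨⟨a, ha, h⟩, h'⟩ := h
  refine ⟨⟨a, ha, ?_⟩, fun u hu => ?_⟩
  · rwa [← hσ _ (by omega), ← hc v ha.mem_leaves]
  · rw [← hc v ha.mem_leaves, ← hc u hu.mem_leaves.2, h' u hu]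

theorem happyCount_congr (hσ : ∀ k < w + w, σ k = τ k) (hc : ∀ v ∈ Φ.leaves, c v = c' v) :
    Φ.happyCount σ c = Φ.happyCount τ c' :=
  congrArg Set.ncard <| Set.ext fun _ => ⟨StaysHappy.congr hσ hc,
    StaysHappy.congr (fun k hk => (hσ k hk).symm) fun v hv => (hc v hv).symm⟩

theorem best_congr (hσ : ∀ k < w + w, σ k = τ k) : Φ.best p σ = Φ.best p τ := by
  have key : ∀ {σ τ : ℕ → ℕ}, (∀ k < w + w, σ k = τ k) → Φ.best p σ ≤ Φ.best p τ := fun h =>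
    best_le fun c hc => by
      rw [happyCount_congr h fun _ _ => rfl]
      exact (hc.congr h fun _ _ => rfl).le_best
  exact (key hσ).antisymm (key fun k hk => (hσ k hk).symm)

theorem best_vertex (i : Fin w) (v : Fin n) : (vertex i v).best p σ =
    vertexEntry ℓ (σ i) (σ (w + i)) ((p v).elim 0 fun a => (a : ℕ) + 1) := by
  have hp : ∀ x : Fin ℓ, (∀ y, p v = some y → x = y) ↔
      ((p v).elim 0 fun a => (a : ℕ) + 1) = 0 ∨
        ((p v).elim 0 fun a => (a : ℕ) + 1) = x + 1 := fun x => by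
    cases p v with
    | none => simp
    | some y => simp [Fin.val_inj, eq_comm]
  have hv : ∀ c : Fin n → Fin ℓ, (vertex i v).Valid p σ c ↔
      (σ i = c v + 1 ∨ σ i = ℓ + 1) ∧ ∀ x, p v = some x → c v = x := fun c =>
    ⟨fun h => h v i ⟨rfl, rfl⟩, by rintro h _ _ ⟨rfl, rfl⟩; exact h⟩
  have hc : ∀ c : Fin n → Fin ℓ, (vertex i v).happyCount σ c + 1 =
      if σ (w + i) = 0 ∨ σ (w + i) = c v + 1 then 2 else 1 := fun c => by
    have : {u | (vertex i v).StaysHappy σ c u} =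
        {u | u = v ∧ (σ (w + i) = 0 ∨ σ (w + i) = c v + 1)} := Set.ext fun u => by
      constructor
      · rintro ⟨⟨_, ⟨rfl, rfl⟩, h⟩, -⟩
        exact ⟨rfl, h⟩
      · rintro ⟨rfl, h⟩
        exact ⟨⟨i, ⟨rfl, rfl⟩, h⟩, fun _ h => h.elim⟩
    rw [happyCount, this]
    split_ifs with h <;> simp [h]
  refine (best_le fun c h => ?_).antisymm (Finset.sup_le fun x hx => ?_)
  · refine le_trans ?_ (Finset.le_sup (b := (c v : ℕ)) (Finset.mem_range.2 (c v).2))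
    rw [hv, hp] at h
    rw [hc, if_pos h]
  · split_ifs with h h' <;> try exact Nat.zero_le _
    all_goals
      -- The constant coloring with color `x` attains this term of the supremum.
      let y : Fin ℓ := ⟨x, Finset.mem_range.1 hx⟩
      have := ((hv fun _ => y).2 ⟨h.1, (hp y).2 h.2⟩).le_best
      rw [hc] at this
      simpa only [y, h', if_true, if_false] using this

/-- No edges run between the parts and their leaves are disjoint, so validity splits and the happy
counts add under one and the same state. -/
theorem best_union (h : (union Φ₁ Φ₂).leaves.Nodup) :
    (union Φ₁ Φ₂).best p σ = unionEntry (Φ₁.best p σ) (Φ₂.best p σ) := by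
  obtain ⟨-, -, hd⟩ := List.nodup_append'.1 h
  have hv : ∀ c : Fin n → Fin ℓ, (union Φ₁ Φ₂).Valid p σ c ↔ Φ₁.Valid p σ c ∧ Φ₂.Valid p σ c :=
    fun c => ⟨fun h => ⟨fun v a ha => h v a (.inl ha), fun v a ha => h v a (.inr ha)⟩,
      fun h v a ha => ha.elim (h.1 v a) (h.2 v a)⟩
  have hc : ∀ c : Fin n → Fin ℓ,
      (union Φ₁ Φ₂).happyCount σ c = Φ₁.happyCount σ c + Φ₂.happyCount σ c := fun c => by
    rw [happyCount, happyCount, happyCount, ← Set.ncard_union_eq]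
    · congr 1
      ext v
      constructor
      · rintro ⟨⟨a, ha | ha, h⟩, h'⟩
        · exact .inl ⟨⟨a, ha, h⟩, fun u hu => h' u (.inl hu)⟩
        · exact .inr ⟨⟨a, ha, h⟩, fun u hu => h' u (.inr hu)⟩
      · rintro (⟨⟨a, ha, h⟩, h'⟩ | ⟨⟨a, ha, h⟩, h'⟩)
        · exact ⟨⟨a, .inl ha, h⟩, fun u hu => hu.elim (h' u) fun hu =>
            (hd ha.mem_leaves hu.mem_leaves.1).elim⟩
        · exact ⟨⟨a, .inr ha, h⟩, fun u hu => hu.elim (fun hu =>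
            (hd hu.mem_leaves.1 ha.mem_leaves).elim) (h' u)⟩
    · refine Set.disjoint_left.2 ?_
      rintro v ⟨⟨a, ha, -⟩, -⟩ ⟨⟨b, hb, -⟩, -⟩
      exact hd ha.mem_leaves hb.mem_leaves
  refine (best_le fun c h => ?_).antisymm ?_
  · have h₁ := ((hv c).1 h).1.le_best
    have h₂ := ((hv c).1 h).2.le_best
    rw [hc, unionEntry, if_neg (by omega), if_neg (by omega)]
    omega
  · rw [unionEntry]
    split_ifs with h₁ h₂ <;> try exact Nat.zero_le _
    classical
    obtain ⟨c₁, v₁, e₁⟩ := exists_best h₁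
    obtain ⟨c₂, v₂, e₂⟩ := exists_best h₂
    -- Optimal colorings of the parts are glued along the leaves of `Φ₁`.
    let c : Fin n → Fin ℓ := fun v => if v ∈ Φ₁.leaves then c₁ v else c₂ v
    have hc₁ : ∀ v ∈ Φ₁.leaves, c₁ v = c v := fun v hv => (if_pos hv).symm
    have hc₂ : ∀ v ∈ Φ₂.leaves, c₂ v = c v := fun v hv => (if_neg fun hv' => hd hv' hv).symm
    have := ((hv c).2 ⟨v₁.congr (fun _ _ => rfl) hc₁, v₂.congr (fun _ _ => rfl) hc₂⟩).le_best
    rw [hc, ← happyCount_congr (fun _ _ => rfl) hc₁, ← happyCount_congr (fun _ _ => rfl) hc₂]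
      at this
    omega

/-- A bound on the new class of `j` is the same bound on both old classes, so colorings correspond
one to one, with equal counts. -/
theorem best_relabel (i j : Fin w) :
    (relabel i j Φ).best p σ = Φ.best p (relabelState w i j σ) := by
  have h1 : ∀ a : Fin w, relabelState w i j σ a = if a = i then σ j else σ a := fun a => by
    simp only [relabelState, Fin.ext_iff, show (a : ℕ) ≠ w + i by omega, if_false]
  have h2 : ∀ a : Fin w, relabelState w i j σ (w + a) =
      if a = i then σ (w + j) else σ (w + a) := fun a => by
    simp only [relabelState, Fin.ext_iff, show w + (a : ℕ) ≠ i by omega, if_false,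
      Nat.add_left_cancel_iff]
  have hv : ∀ c : Fin n → Fin ℓ, (relabel i j Φ).Valid p σ c ↔
      Φ.Valid p (relabelState w i j σ) c := fun c => by
    constructor
    · intro h v a ha
      rw [h1]
      split_ifs with hai
      · exact h v j (.inr ⟨hai ▸ ha, rfl⟩)
      · exact h v a (.inl ⟨ha, hai⟩)
    · rintro h v a (⟨ha, hai⟩ | ⟨ha, rfl⟩)
      · simpa only [h1, if_neg hai] using h v a ha
      · simpa only [h1, if_true] using h v i ha
  have hc : ∀ c : Fin n → Fin ℓ, (relabel i j Φ).happyCount σ c =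
      Φ.happyCount (relabelState w i j σ) c := fun c => by
    refine congrArg Set.ncard <| Set.ext fun v => and_congr_left fun _ => ?_
    constructor
    · rintro ⟨a, ⟨ha, hai⟩ | ⟨ha, rfl⟩, h⟩
      · exact ⟨a, ha, by rwa [h2, if_neg hai]⟩
      · exact ⟨i, ha, by rwa [h2, if_pos rfl]⟩
    · rintro ⟨a, ha, h⟩
      rw [h2] at h
      split_ifs at h with hai
      · exact ⟨j, .inr ⟨hai ▸ ha, rfl⟩, h⟩
      · exact ⟨a, .inl ⟨ha, hai⟩, h⟩
  classical
  exact Finset.sup_congr rfl fun c _ => by rw [if_congr (hv c) rfl rfl, hc]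

/-- For `≤`, guess the least bounds of the two classes under a given coloring: whoever is happy
after the join finds the other class empty or entirely of its own color, so it also meets the
enlarged promise. For `≥`, a guess only overestimates the classes, so whoever meets the enlarged
promise is happy after the join. -/
theorem best_join (i j : Fin w) (hij : i ≠ j) (hΦ : Φ.leaves.Nodup) :
    (join i j hij Φ).best p σ = joinEntry ℓ w i j σ (Φ.best p) := by
  have hij' : (i : ℕ) ≠ j := Fin.val_ne_of_ne hij
  have h1 : ∀ (s t : ℕ) (a : Fin w), joinState ℓ w i j s t σ a =
      if a = i then s else if a = j then t else σ a := fun s t a => by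
    simp only [joinState, Fin.ext_iff, show (a : ℕ) ≠ w + i by omega,
      show (a : ℕ) ≠ w + j by omega, if_false]
  have h2 : ∀ (s t : ℕ) (a : Fin w), joinState ℓ w i j s t σ (w + a) =
      if a = i then lub ℓ (σ (w + i)) t else if a = j then lub ℓ (σ (w + j)) s else σ (w + a) :=
    fun s t a => by
      simp only [joinState, Fin.ext_iff, show w + (a : ℕ) ≠ i by omega,
        show w + (a : ℕ) ≠ j by omega, if_false, Nat.add_left_cancel_iff]
  refine (best_le fun c h => ?_).antisymm (Finset.sup_le fun s hs => Finset.sup_le fun t ht => ?_)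
  -- The least bound of a class: `0` if it is empty, `x + 1` if it has the single color `x`, and `ℓ
  -- + 1` otherwise.
  · have bound : ∀ a : Fin w, ∃ s < ℓ + 2, lub ℓ s (σ a) = σ a ∧
        (∀ v, Φ.HasLabel v a → s = c v + 1 ∨ s = ℓ + 1) ∧
        ∀ x : Fin ℓ, (∀ v, Φ.HasLabel v a → c v = x) → s = 0 ∨ s = x + 1 := by
      intro a
      by_cases hne : ∃ v, Φ.HasLabel v a
      · obtain ⟨v, hv⟩ := hne
        by_cases hmono : ∀ u, Φ.HasLabel u a → c u = c v
        · refine ⟨c v + 1, by omega, lub_eq_right_iff.2 (.inr ?_),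
            fun u hu => .inl (by rw [hmono u hu]), fun x hx => .inr (by rw [hx v hv])⟩
          exact (h v a hv).1.imp Eq.symm id
        · push Not at hmono
          obtain ⟨u, hu, huv⟩ := hmono
          refine ⟨ℓ + 1, by omega, lub_eq_right_iff.2 (.inr (.inr ?_)), fun _ _ => .inr rfl,
            fun x hx => (huv ((hx u hu).trans (hx v hv).symm)).elim⟩
          have := (h v a hv).1
          have := (h u a hu).1
          have := Fin.val_ne_of_ne huv
          omega
      · exact ⟨0, by omega, lub_eq_right_iff.2 (.inl rfl), fun v hv => (hne ⟨v, hv⟩).elim,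
          fun _ _ => .inl rfl⟩
    obtain ⟨s, hs, hsi, hsv, hsx⟩ := bound i
    obtain ⟨t, ht, htj, htv, htx⟩ := bound j
    refine le_trans ?_ (Finset.le_sup (b := s) (Finset.mem_range.2 hs))
    refine le_trans ?_ (Finset.le_sup (b := t) (Finset.mem_range.2 ht))
    rw [if_pos hsi, if_pos htj]
    have hv : Φ.Valid p (joinState ℓ w i j s t σ) c := fun v a ha => by
      refine ⟨?_, (h v a ha).2⟩
      rw [h1]
      split_ifs with hai haj
      · exact hsv v (hai ▸ ha)
      · exact htv v (haj ▸ ha)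
      · exact (h v a ha).1
    refine le_trans (Nat.succ_le_succ (Set.ncard_le_ncard ?_ (Set.toFinite _))) hv.le_best
    rintro v ⟨⟨a, ha, hσ⟩, hadj⟩
    refine ⟨⟨a, ha, ?_⟩, fun u hu => hadj u (.inl hu)⟩
    rw [h2]
    split_ifs with hai haj
    · subst hai
      exact (lub_eq_zero_or_iff (c v).2).2
        ⟨hσ, htx _ fun u hu => hadj u (.inr (.inl ⟨ha, hu⟩))⟩
    · subst haj
      exact (lub_eq_zero_or_iff (c v).2).2
        ⟨hσ, hsx _ fun u hu => hadj u (.inr (.inr ⟨ha, hu⟩))⟩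
    · exact hσ
  · split_ifs with hsi htj <;> try exact Nat.zero_le _
    refine best_le fun c h => ?_
    have hsi' := lub_eq_right_iff.1 hsi
    have htj' := lub_eq_right_iff.1 htj
    have hi : ∀ v, Φ.HasLabel v i → s = c v + 1 ∨ s = ℓ + 1 := fun v hv => by
      simpa only [h1, if_true] using (h v i hv).1
    have hj : ∀ v, Φ.HasLabel v j → t = c v + 1 ∨ t = ℓ + 1 := fun v hv => by
      simpa only [h1, if_neg hij.symm, if_true] using (h v j hv).1
    have hv : (join i j hij Φ).Valid p σ c := fun v a (ha : Φ.HasLabel v a) => by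
      refine ⟨?_, (h v a ha).2⟩
      have := (h v a ha).1
      rw [h1] at this
      split_ifs at this with hai haj
      · subst hai
        have := (c v).2
        omega
      · subst haj
        have := (c v).2
        rw [Finset.mem_range] at ht
        omega
      · exact this
    refine le_trans (Nat.succ_le_succ (Set.ncard_le_ncard ?_ (Set.toFinite _))) hv.le_best
    rintro v ⟨⟨a, ha, hσ⟩, hadj⟩
    rw [h2] at hσ
    refine ⟨⟨a, ha, ?_⟩, ?_⟩
    · split_ifs at hσ with hai haj
      · exact hai ▸ ((lub_eq_zero_or_iff (c v).2).1 hσ).1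
      · exact haj ▸ ((lub_eq_zero_or_iff (c v).2).1 hσ).1
      · exact hσ
    · rintro u (hu | ⟨hvi, hu⟩ | ⟨hvj, hu⟩)
      · exact hadj u hu
      -- Labels are unique, so the promise in `hσ` is that of class `i` and forces `t` to be `0` or
      -- the color of `v`; as `t` also bounds the color of `u`, the two colors agree.
      · obtain rfl := ha.unique hΦ hvi
        rw [if_pos rfl, lub_eq_zero_or_iff (c v).2] at hσ
        have := hj u hu
        exact Fin.ext (by omega)
      · obtain rfl := ha.unique hΦ hvj
        rw [if_neg hij.symm, if_pos rfl, lub_eq_zero_or_iff (c v).2] at hσ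
        have := hi u hu
        exact Fin.ext (by omega)

/-- With the top bound on every class, validity just means extending `p`; with empty promises,
staying happy is being happy in `G`. -/
theorem best_root {Ψ : CWExpr (Fin n) w} {G : SimpleGraph (Fin n)} (hΨ : Ψ.Expresses G) (k : ℕ) :
    MHV G p k ↔ k + 1 ≤ Ψ.best p fun i => if i < w then ℓ + 1 else 0 := by
  have hv : ∀ c : Fin n → Fin ℓ, Ψ.Valid p (fun i => if i < w then ℓ + 1 else 0) c ↔
      ∀ v a, p v = some a → c v = a := fun c => by
    refine ⟨fun h v => ?_, fun h v a _ => ⟨.inr (if_pos a.2), h v⟩⟩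
    obtain ⟨a, ha⟩ := exists_hasLabel (hΨ.mem_leaves v)
    exact (h v a ha).2
  have hc : ∀ c : Fin n → Fin ℓ, Ψ.happyCount (fun i => if i < w then ℓ + 1 else 0) c =
      {v | IsHappy G c v}.ncard := fun c => by
    refine congrArg Set.ncard <| Set.ext fun v => ?_
    obtain ⟨a, ha⟩ := exists_hasLabel (hΨ.mem_leaves v)
    simp only [Set.mem_ofPred_eq, StaysHappy, IsHappy, hΨ.adj_iff]
    exact and_iff_right ⟨a, ha, .inl (if_neg (by omega))⟩
  constructor
  · rintro ⟨c, hp, hk⟩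
    have := ((hv c).2 hp).le_best
    rw [hc] at this
    omega
  · intro h
    obtain ⟨c, hc', he⟩ := exists_best (Nat.ne_zero_of_lt h)
    exact ⟨c, (hv c).1 hc', by rw [← hc]; omega⟩

end CWExpr

/-! ### The dynamic program on the machine

States are stored as numbers in base `ℓ + 2`. The `t`-th table belongs to the subexpression whose
code ends with the `t`-th operator. It has one entry for each state, and a last entry for the size
of the subexpression. -/

def digit (q x k : ℕ) : ℕ := x / q ^ k % q

theorem digit_lt {ℓ : ℕ} (x i : ℕ) : digit (ℓ + 2) x i < ℓ + 2 := Nat.mod_lt _ (by omega)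

def ofDigits (q d : ℕ) (f : ℕ → ℕ) : ℕ := ∑ k ∈ Finset.range d, q ^ k * f k

/-- Entry `x` of table `t`, for tables with `M` states from the address `b` on. -/
def tableEntry (b M : ℕ) (m : ℕ → ℕ) (t x : ℕ) : ℕ := m (b + ((M + 1) * t + x))

/-- The address of the code of the expression. -/
def codeStart (n : ℕ) : ℕ := n * n + 5 + n

/-- The address of the tables. -/
def tableStart (n N : ℕ) : ℕ := codeStart n + (N + (N + N))

/-- The value of an entry, computed from an operator and the preceding tables. -/
def stepEntry (ℓ w M : ℕ) (pre : ℕ → ℕ) (T : ℕ → ℕ → ℕ) (op a b t x : ℕ) : ℕ :=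
  -- In postfix order the last operand has table `t - 1`. The size stored in its entry `M` shows
  -- that the left operand of a union has table `t - 1 - T (t - 1) M`.
  if x = M then
    if op = 0 then 1
    else if op = 1 then T (t - 1) M + T (t - 1 - T (t - 1) M) M + 1
    else T (t - 1) M + 1
  else if op = 0 then vertexEntry ℓ (digit (ℓ + 2) x a) (digit (ℓ + 2) x (w + a)) (pre b)
  else if op = 1 then unionEntry (T (t - 1 - T (t - 1) M) x) (T (t - 1) x)
  else if op = 2 then
    T (t - 1) (ofDigits (ℓ + 2) (w + w) (relabelState w a b (digit (ℓ + 2) x)))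
  else joinEntry ℓ w a b (digit (ℓ + 2) x) fun τ => T (t - 1) (ofDigits (ℓ + 2) (w + w) τ)

/-- The content of the cell `tableStart n N + y`. -/
def entry (ℓ n w N : ℕ) (m : ℕ → ℕ) (y : ℕ) : ℕ :=
  let M := (ℓ + 2) ^ (w + w)
  let t := y / (M + 1)
  let c := codeStart n + (t + (t + t))
  stepEntry ℓ w M (fun v => m (n * n + 5 + v)) (tableEntry (tableStart n N) M m)
    (m c) (m (c + 1)) (m (c + 2)) t (y % (M + 1))

/-! ### Terms for the table entries -/

namespace Tm

def cell (i : ℕ) : Tm := load (lit i)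

def base : Tm := add (cell 0) (lit 2)

def states : Tm := pow base (add (cell 3) (cell 3))

def preStart : Tm := add (mul (cell 2) (cell 2)) (lit 5)

def codeStart : Tm := add preStart (cell 2)

def tableStart : Tm := add codeStart (add (cell 4) (add (cell 4) (cell 4)))

def digit (x k : Tm) : Tm := mod (div x (pow base k)) base

def ofDigits (f : Tm → Tm) : Tm := bsum (add (cell 3) (cell 3)) fun k => mul (pow base k) (f k)

def tableEntry (t x : Tm) : Tm :=
  load (add tableStart (add (mul (add states (lit 1)) t) x))

def lub (x y : Tm) : Tm :=
  ifEq x (lit 0) y <| ifEq y (lit 0) x <| ifEq x y x (add (cell 0) (lit 1))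

def relabelState (i j : Tm) (σ : Tm → Tm) (k : Tm) : Tm :=
  ifEq k i (σ j) <| ifEq k (add (cell 3) i) (σ (add (cell 3) j)) (σ k)

def joinState (i j s t : Tm) (σ : Tm → Tm) (k : Tm) : Tm :=
  ifEq k i s <| ifEq k j t <| ifEq k (add (cell 3) i) (lub (σ (add (cell 3) i)) t) <|
    ifEq k (add (cell 3) j) (lub (σ (add (cell 3) j)) s) (σ k)

def vertexEntry (s t p : Tm) : Tm := bmax (cell 0) fun c =>
  let val := ifEq t (lit 0) (lit 2) <| ifEq t (add c (lit 1)) (lit 2) (lit 1)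
  let pre := ifEq p (lit 0) val <| ifEq p (add c (lit 1)) val (lit 0)
  ifEq s (add c (lit 1)) pre <| ifEq s (add (cell 0) (lit 1)) pre (lit 0)

def unionEntry (x y : Tm) : Tm :=
  ifEq x (lit 0) (lit 0) <| ifEq y (lit 0) (lit 0) <| sub (add x y) (lit 1)

def joinEntry (i j : Tm) (σ : Tm → Tm) (g : (Tm → Tm) → Tm) : Tm :=
  bmax base fun s => bmax base fun t => ifEq (lub s (σ i)) (σ i)
    (ifEq (lub t (σ j)) (σ j) (g (joinState i j s t σ)) (lit 0)) (lit 0)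

def stepEntry (op a b t x : Tm) : Tm :=
  let prev := sub t (lit 1)
  let prev₂ := sub prev (tableEntry prev states)
  ifEq x states
    (ifEq op (lit 0) (lit 1) <|
      ifEq op (lit 1)
        (add (add (tableEntry prev states) (tableEntry prev₂ states)) (lit 1))
        (add (tableEntry prev states) (lit 1))) <|
    ifEq op (lit 0)
      (vertexEntry (digit x a) (digit x (add (cell 3) a)) (load (add preStart b))) <|
    ifEq op (lit 1) (unionEntry (tableEntry prev₂ x) (tableEntry prev x)) <|
    ifEq op (lit 2) (tableEntry prev (ofDigits (relabelState a b (digit x)))) <|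
    joinEntry a b (digit x) fun τ => tableEntry prev (ofDigits τ)

def entry (y : Tm) : Tm :=
  let t := div y (add states (lit 1))
  let c := add codeStart (add t (add t t))
  stepEntry (load c) (load (add c (lit 1))) (load (add c (lit 2))) t (mod y (add states (lit 1)))

end Tm

/-! ### Values of these terms -/

/-- The memory `m` starts with the given parameters, and `X` bounds what the program counts to. -/
structure Setting (X ℓ k n w N : ℕ) (m : ℕ → ℕ) : Prop where
  cell_zero : m 0 = ℓ
  cell_one : m 1 = k
  cell_two : m 2 = n
  cell_three : m 3 = w
  cell_four : m 4 = N
  two_le : 2 ≤ X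
  base_le : ℓ + 2 ≤ X
  args_le : w + w + n + 3 ≤ X
  states_le : (ℓ + 2) ^ (w + w) ≤ X
  tables_le : ((ℓ + 2) ^ (w + w) + 1) * N ≤ X
  size_le : N ≤ X

/-- The function `F` on numbers up to `X` is computed by `f`. -/
def DenFun (X : ℕ) (m : ℕ → ℕ) (Γ : Ctx) (f : Tm → Tm) (F : ℕ → ℕ) : Prop :=
  ∀ Γ', Γ.Le Γ' → ∀ t, ∀ k ≤ X, Den X m Γ' t k → Den X m Γ' (f t) (F k)

theorem DenFun.mono {X : ℕ} {m : ℕ → ℕ} {Γ Γ' : Ctx} {f : Tm → Tm} {F : ℕ → ℕ}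
    (h : DenFun X m Γ f F) (hΓ : Γ.Le Γ') : DenFun X m Γ' f F :=
  fun Γ'' hΓ' => h Γ'' (hΓ.trans hΓ')

theorem DenFun.apply {X : ℕ} {m : ℕ → ℕ} {Γ : Ctx} {f : Tm → Tm} {F : ℕ → ℕ}
    (h : DenFun X m Γ f F) {t : Tm} {k : ℕ} (ht : Den X m Γ t k) (hk : k ≤ X) :
    Den X m Γ (f t) (F k) :=
  h Γ (.refl Γ) t k hk ht

namespace Setting

variable {X ℓ k n w N : ℕ} {m : ℕ → ℕ} {Γ Γ' : Ctx}

theorem den_lit (h : Setting X ℓ k n w N m) (c : ℕ) : Den X m Γ (.lit c) c := .lit h.two_le c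

theorem den_cell (h : Setting X ℓ k n w N m) (i : ℕ) : Den X m Γ (.cell i) (m i) :=
  .load h.two_le (h.den_lit i)

theorem den_colors (h : Setting X ℓ k n w N m) : Den X m Γ (.cell 0) ℓ :=
  (h.den_cell 0).of_eq h.cell_zero

theorem den_order (h : Setting X ℓ k n w N m) : Den X m Γ (.cell 2) n :=
  (h.den_cell 2).of_eq h.cell_two

theorem den_width (h : Setting X ℓ k n w N m) : Den X m Γ (.cell 3) w :=
  (h.den_cell 3).of_eq h.cell_three

theorem den_size (h : Setting X ℓ k n w N m) : Den X m Γ (.cell 4) N :=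
  (h.den_cell 4).of_eq h.cell_four

theorem den_base (h : Setting X ℓ k n w N m) : Den X m Γ .base (ℓ + 2) :=
  .add h.two_le h.den_colors (h.den_lit 2)

theorem den_states (h : Setting X ℓ k n w N m) : Den X m Γ .states ((ℓ + 2) ^ (w + w)) :=
  .pow h.two_le h.den_base (.add h.two_le h.den_width h.den_width) h.base_le
    (by have := h.args_le; omega)

theorem den_preStart (h : Setting X ℓ k n w N m) : Den X m Γ .preStart (n * n + 5) :=
  .add h.two_le (.mul h.two_le h.den_order h.den_order (by have := h.args_le; omega)) (h.den_lit 5)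

theorem den_codeStart (h : Setting X ℓ k n w N m) : Den X m Γ .codeStart (codeStart n) :=
  .add h.two_le h.den_preStart h.den_order

theorem den_tableStart (h : Setting X ℓ k n w N m) : Den X m Γ .tableStart (tableStart n N) :=
  .add h.two_le h.den_codeStart (.add h.two_le h.den_size (.add h.two_le h.den_size h.den_size))

theorem den_digit (h : Setting X ℓ k n w N m) {tx : Tm} {x : ℕ} (hx : Den X m Γ tx x)
    (hxX : x ≤ X) : DenFun X m Γ (.digit tx) (digit (ℓ + 2) x) := fun _ hΓ _ i hi ht =>
  .mod h.two_le (.div h.two_le (hx.mono hΓ) (.pow h.two_le h.den_base ht h.base_le hi) hxX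
    (by positivity)) h.den_base ((Nat.div_le_self _ _).trans hxX) (by omega)

theorem den_ofDigits (h : Setting X ℓ k n w N m) {f : Tm → Tm} {F : ℕ → ℕ}
    (hf : DenFun X m Γ f F) (hF : ∀ i, F i < ℓ + 2) :
    Den X m Γ (.ofDigits f) (ofDigits (ℓ + 2) (w + w) F) := by
  have hw := h.args_le
  have hb := h.base_le
  exact .bsum h.two_le (.add h.two_le h.den_width h.den_width) (by omega)
    fun i hi Γ' hΓ t ht => .mul h.two_le (.pow h.two_le h.den_base ht hb (by omega))
      ((hf.mono hΓ).apply ht (by omega)) (by have := hF i; omega)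

theorem den_tableEntry (h : Setting X ℓ k n w N m) {tt tx : Tm} {t x : ℕ} (ht : Den X m Γ tt t)
    (hx : Den X m Γ tx x) (htX : t ≤ X) :
    Den X m Γ (.tableEntry tt tx) (tableEntry (tableStart n N) ((ℓ + 2) ^ (w + w)) m t x) :=
  .load h.two_le (.add h.two_le h.den_tableStart (.add h.two_le
    (.mul h.two_le (.add h.two_le h.den_states (h.den_lit 1)) ht htX) hx))

theorem den_lub (h : Setting X ℓ k n w N m) {tx ty : Tm} {x y : ℕ} (hx : Den X m Γ tx x)
    (hy : Den X m Γ ty y) : Den X m Γ (.lub tx ty) (lub ℓ x y) :=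
  .ifEq h.two_le hx (h.den_lit 0) (fun _ => hy) fun _ => .ifEq h.two_le hy (h.den_lit 0)
    (fun _ => hx) fun _ => .ifEq h.two_le hx hy (fun _ => hx) fun _ =>
      .add h.two_le h.den_colors (h.den_lit 1)

theorem den_relabelState (h : Setting X ℓ k n w N m) {ti tj : Tm} {i j : ℕ} {f : Tm → Tm}
    {σ : ℕ → ℕ} (hi : Den X m Γ ti i) (hj : Den X m Γ tj j) (hf : DenFun X m Γ f σ)
    (hjX : w + j ≤ X) : DenFun X m Γ (.relabelState ti tj f) (relabelState w i j σ) :=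
  fun Γ' hΓ t a ha ht =>
    have hi := hi.mono hΓ
    have hj := hj.mono hΓ
    have hf := hf.mono hΓ
    .ifEq h.two_le ht hi (fun _ => hf.apply hj (by omega)) fun _ =>
      .ifEq h.two_le ht (.add h.two_le h.den_width hi)
        (fun _ => hf.apply (.add h.two_le h.den_width hj) hjX) fun _ => hf.apply ht ha

theorem den_joinState (h : Setting X ℓ k n w N m) {ti tj ts tt : Tm} {i j s t : ℕ} {f : Tm → Tm}
    {σ : ℕ → ℕ} (hi : Den X m Γ ti i) (hj : Den X m Γ tj j) (hs : Den X m Γ ts s)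
    (ht : Den X m Γ tt t) (hf : DenFun X m Γ f σ) (hiX : w + i ≤ X) (hjX : w + j ≤ X) :
    DenFun X m Γ (.joinState ti tj ts tt f) (joinState ℓ w i j s t σ) := fun _ hΓ _ _ ha hk =>
  have hi := hi.mono hΓ
  have hj := hj.mono hΓ
  have hs := hs.mono hΓ
  have ht := ht.mono hΓ
  have hf := hf.mono hΓ
  have hi' := .add h.two_le h.den_width hi
  have hj' := .add h.two_le h.den_width hj
  .ifEq h.two_le hk hi (fun _ => hs) fun _ => .ifEq h.two_le hk hj (fun _ => ht) fun _ =>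
    .ifEq h.two_le hk hi' (fun _ => h.den_lub (hf.apply hi' hiX) ht) fun _ =>
      .ifEq h.two_le hk hj' (fun _ => h.den_lub (hf.apply hj' hjX) hs) fun _ => hf.apply hk ha

theorem den_vertexEntry (h : Setting X ℓ k n w N m) {ts tt tp : Tm} {s t p : ℕ}
    (hs : Den X m Γ ts s) (ht : Den X m Γ tt t) (hp : Den X m Γ tp p) :
    Den X m Γ (.vertexEntry ts tt tp) (vertexEntry ℓ s t p) := by
  refine .bmax h.two_le h.den_colors (by have := h.base_le; omega) fun c _ Γ' hΓ tc hc => ?_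
  have hc := Den.add h.two_le hc (h.den_lit 1)
  have hval := Den.ifEq h.two_le (ht.mono hΓ) (h.den_lit 0) (fun _ => h.den_lit 2) fun _ =>
    .ifEq h.two_le (ht.mono hΓ) hc (fun _ => h.den_lit 2) fun _ => h.den_lit 1
  have hpre := Den.ifEq h.two_le (hp.mono hΓ) (h.den_lit 0) (fun _ => hval) fun _ =>
    .ifEq h.two_le (hp.mono hΓ) hc (fun _ => hval) fun _ => h.den_lit 0
  refine (Den.ifEq h.two_le (hs.mono hΓ) hc (fun _ => hpre) fun _ =>
    .ifEq h.two_le (hs.mono hΓ) (.add h.two_le h.den_colors (h.den_lit 1)) (fun _ => hpre)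
      fun _ => h.den_lit 0).of_eq ?_
  simp only [ite_or, ite_and]

theorem den_unionEntry (h : Setting X ℓ k n w N m) {tx ty : Tm} {x y : ℕ} (hx : Den X m Γ tx x)
    (hy : Den X m Γ ty y) : Den X m Γ (.unionEntry tx ty) (unionEntry x y) :=
  .ifEq h.two_le hx (h.den_lit 0) (fun _ => h.den_lit 0) fun _ =>
    .ifEq h.two_le hy (h.den_lit 0) (fun _ => h.den_lit 0) fun _ =>
      .sub h.two_le (.add h.two_le hx hy) (h.den_lit 1)

/-- The term `g` acts on representations of states; it need only be right for states with digits
below `ℓ + 2`, which `joinState` preserves. -/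
theorem den_joinEntry (h : Setting X ℓ k n w N m) {ti tj : Tm} {i j : ℕ} {f : Tm → Tm}
    {σ : ℕ → ℕ} {g : (Tm → Tm) → Tm} {γ : (ℕ → ℕ) → ℕ} (hi : Den X m Γ ti i)
    (hj : Den X m Γ tj j) (hf : DenFun X m Γ f σ) (hσ : ∀ a, σ a < ℓ + 2)
    (hiX : w + i ≤ X) (hjX : w + j ≤ X)
    (hg : ∀ Γ', Γ.Le Γ' → ∀ f' τ, (∀ a, τ a < ℓ + 2) → DenFun X m Γ' f' τ →
      Den X m Γ' (g f') (γ τ)) :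
    Den X m Γ (.joinEntry ti tj f g) (joinEntry ℓ w i j σ γ) := by
  refine .bmax h.two_le h.den_base h.base_le fun s hs Γ₁ hΓ₁ ts hts => ?_
  refine .bmax h.two_le h.den_base h.base_le fun t ht Γ₂ hΓ₂ tt htt => ?_
  have hΓ := hΓ₁.trans hΓ₂
  have hi := hi.mono hΓ
  have hj := hj.mono hΓ
  have hf := hf.mono hΓ
  have hσi := hf.apply hi (by omega)
  have hσj := hf.apply hj (by omega)
  have hts := hts.mono hΓ₂
  refine .ifEq h.two_le (h.den_lub hts hσi) hσi (fun _ => .ifEq h.two_le (h.den_lub htt hσj) hσj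
    (fun _ => hg Γ₂ hΓ _ _ (joinState_lt hσ hs ht) (h.den_joinState hi hj hts htt hf hiX hjX))
    fun _ => h.den_lit 0) fun _ => h.den_lit 0

theorem den_stepEntry (h : Setting X ℓ k n w N m) {top ta tb tt tx : Tm} {op a b t x : ℕ}
    (hop : Den X m Γ top op) (ha : Den X m Γ ta a) (hb : Den X m Γ tb b) (ht : Den X m Γ tt t)
    (hx : Den X m Γ tx x) (haX : w + a ≤ X) (hbX : w + b ≤ X) (htX : t ≤ X) (hxX : x ≤ X) :
    Den X m Γ (.stepEntry top ta tb tt tx)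
      (stepEntry ℓ w ((ℓ + 2) ^ (w + w)) (fun v => m (n * n + 5 + v))
        (tableEntry (tableStart n N) ((ℓ + 2) ^ (w + w)) m) op a b t x) := by
  have hX := h.two_le
  have h1 := Den.sub hX ht (h.den_lit 1)
  have hsz := h.den_tableEntry h1 h.den_states (by omega)
  have h2 := Den.sub hX h1 hsz
  have hσ := h.den_digit hx hxX
  exact .ifEq hX hx h.den_states
    (fun _ => .ifEq hX hop (h.den_lit 0) (fun _ => h.den_lit 1) fun _ =>
      .ifEq hX hop (h.den_lit 1) (fun _ => .add hX (.add hX hsz (h.den_tableEntry h2 h.den_states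
        (by omega))) (h.den_lit 1)) fun _ => .add hX hsz (h.den_lit 1))
    fun _ => .ifEq hX hop (h.den_lit 0) (fun _ => h.den_vertexEntry (hσ.apply ha (by omega))
      (hσ.apply (.add hX h.den_width ha) haX) (.load hX (.add hX h.den_preStart hb)))
    fun _ => .ifEq hX hop (h.den_lit 1) (fun _ => h.den_unionEntry
      (h.den_tableEntry h2 hx (by omega)) (h.den_tableEntry h1 hx (by omega)))
    fun _ => .ifEq hX hop (h.den_lit 2) (fun _ => h.den_tableEntry h1 (h.den_ofDigits
      (h.den_relabelState ha hb hσ hbX) (relabelState_lt (digit_lt x))) (by omega))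
    fun _ => h.den_joinEntry ha hb hσ (digit_lt x) haX hbX fun Γ' hΓ f' τ hτ hf' =>
      h.den_tableEntry (h1.mono hΓ) (h.den_ofDigits hf' hτ) (by omega)

theorem den_entry (h : Setting X ℓ k n w N m) {ty : Tm} {y : ℕ} (hy : Den X m Γ ty y)
    (hyN : y < ((ℓ + 2) ^ (w + w) + 1) * N)
    (hm : ∀ i < N + (N + N), m (codeStart n + i) ≤ w + n + 3) :
    Den X m Γ (.entry ty) (entry ℓ n w N m y) := by
  have hX := h.two_le
  have hyX : y ≤ X := hyN.le.trans h.tables_le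
  have hM := Den.add (Γ := Γ) hX h.den_states (h.den_lit 1)
  have hMpos : 0 < (ℓ + 2) ^ (w + w) + 1 := Nat.succ_pos _
  have ht := Den.div hX hy hM hyX hMpos
  have htN : y / ((ℓ + 2) ^ (w + w) + 1) < N := Nat.div_lt_of_lt_mul hyN
  have hx := Den.mod hX hy hM hyX hMpos
  have hc := Den.add hX h.den_codeStart (.add hX ht (.add hX ht ht))
  have hargs := h.args_le
  -- Every number in the code is at most `w + n + 3`, whichever operator it belongs to; adding `w`
  -- stays within `args_le`.
  have harg : ∀ i ≤ 2, w + m (codeStart n + (y / ((ℓ + 2) ^ (w + w) + 1) +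
      (y / ((ℓ + 2) ^ (w + w) + 1) + y / ((ℓ + 2) ^ (w + w) + 1))) + i) ≤ X := fun i hi => by
    rw [add_assoc]
    have := hm (_ + i) (show y / ((ℓ + 2) ^ (w + w) + 1) + (y / ((ℓ + 2) ^ (w + w) + 1) +
      y / ((ℓ + 2) ^ (w + w) + 1)) + i < _ by omega)
    omega
  exact h.den_stepEntry (.load hX hc) (.load hX (.add hX hc (h.den_lit 1)))
    (.load hX (.add hX hc (h.den_lit 2))) ht hx (harg 1 (by omega)) (harg 2 le_rfl)
    ((Nat.div_le_self _ _).trans hyX) ((Nat.mod_le _ _).trans hyX)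

end Setting

/-! ### States as numbers -/

/-- Identifies the coding with `finFunctionFinEquiv`, from which its range and its inverse are
obtained. -/
theorem ofDigits_eq {q d : ℕ} {f : ℕ → ℕ} (hf : ∀ k, f k < q) :
    ofDigits q d f = (finFunctionFinEquiv fun k : Fin d => (⟨f k, hf k⟩ : Fin q) : Fin (q ^ d)) := by
  rw [finFunctionFinEquiv_apply, ofDigits, Finset.sum_range]
  exact Finset.sum_congr rfl fun _ _ => mul_comm _ _

theorem ofDigits_lt {q d : ℕ} {f : ℕ → ℕ} (hf : ∀ k, f k < q) : ofDigits q d f < q ^ d := by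
  rw [ofDigits_eq hf]
  exact Fin.is_lt _

theorem digit_ofDigits {q d : ℕ} {f : ℕ → ℕ} (hf : ∀ k, f k < q) {k : ℕ} (hk : k < d) :
    digit q (ofDigits q d f) k = f k := by
  have := congrArg (fun g => (g ⟨k, hk⟩ : Fin q).val)
    (finFunctionFinEquiv.symm_apply_apply fun k : Fin d => (⟨f k, hf k⟩ : Fin q))
  rwa [finFunctionFinEquiv_symm_apply_val, ← ofDigits_eq hf] at this

theorem joinEntry_congr {ℓ w i j : ℕ} {σ : ℕ → ℕ} {g g' : (ℕ → ℕ) → ℕ} (hσ : ∀ k, σ k < ℓ + 2)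
    (hg : ∀ τ : ℕ → ℕ, (∀ k, τ k < ℓ + 2) → g τ = g' τ) :
    joinEntry ℓ w i j σ g = joinEntry ℓ w i j σ g' :=
  Finset.sup_congr rfl fun s hs => Finset.sup_congr rfl fun t ht => by
    rw [hg _ (joinState_lt hσ (Finset.mem_range.1 hs) (Finset.mem_range.1 ht))]

/-- An entry reads only strictly earlier tables, and the precoloring only at a vertex creation. The
condition on `t` excludes an operator that would look up its own table because `t - 1` truncates to
`0`. -/
theorem stepEntry_congr {ℓ w : ℕ} {pre pre' : ℕ → ℕ} {T T' : ℕ → ℕ → ℕ} {op a b t x : ℕ}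
    (ht : op = 0 ∨ 0 < t) (hx : x ≤ (ℓ + 2) ^ (w + w)) (hpre : op = 0 → pre b = pre' b)
    (hT : ∀ t' < t, ∀ x ≤ (ℓ + 2) ^ (w + w), T t' x = T' t' x) :
    stepEntry ℓ w ((ℓ + 2) ^ (w + w)) pre T op a b t x =
      stepEntry ℓ w ((ℓ + 2) ^ (w + w)) pre' T' op a b t x := by
  unfold stepEntry
  rcases Nat.eq_zero_or_pos t with rfl | htpos
  · obtain rfl : op = 0 := by omega
    simp [hpre rfl]
  · rw [hT (t - 1) (by omega) _ le_rfl, hT (t - 1 - _) (by omega) _ le_rfl,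
      hT (t - 1) (by omega) _ hx, hT (t - 1 - _) (by omega) _ hx,
      hT (t - 1) (by omega) _ (ofDigits_lt (relabelState_lt (digit_lt x))).le,
      joinEntry_congr (digit_lt x) fun τ hτ => hT (t - 1) (by omega) _ (ofDigits_lt hτ).le]
    by_cases hop : op = 0
    · simp [hop, hpre hop]
    · simp [hop]

/-! ### The tables hold the best values -/

namespace CWExpr

theorem size_pos {V : Type} {w : ℕ} (Φ : CWExpr V w) : 0 < Φ.size := by
  cases Φ <;> simp [size]

theorem leaves_ne_nil {V : Type} {w : ℕ} (Φ : CWExpr V w) : Φ.leaves ≠ [] := by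
  induction Φ with
  | vertex => simp [leaves]
  | union _ _ ih _ => simp [leaves, ih]
  | relabel _ _ _ ih => exact ih
  | join _ _ _ _ ih => exact ih

theorem width_pos {V : Type} {w : ℕ} (Φ : CWExpr V w) : 0 < w := by
  induction Φ with
  | vertex i _ => exact i.pos
  | union _ _ ih _ => exact ih
  | relabel i _ _ _ => exact i.pos
  | join i _ _ _ _ => exact i.pos

variable {n ℓ w : ℕ}

theorem length_code (Φ : CWExpr (Fin n) w) : Φ.code.length = 3 * Φ.size := by
  induction Φ <;> simp_all [code, size] <;> ring

theorem le_of_mem_code {Φ : CWExpr (Fin n) w} {z : ℕ} (hz : z ∈ Φ.code) : z ≤ w + n + 3 := by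
  induction Φ with
  | vertex i v => simp [code] at hz; omega
  | union Φ₁ Φ₂ ih₁ ih₂ =>
    simp only [code, List.mem_append] at hz
    rcases hz with (hz | hz) | hz
    · exact ih₁ hz
    · exact ih₂ hz
    · simp at hz; omega
  | relabel i j Φ ih =>
    rcases List.mem_append.1 hz with hz | hz
    · exact ih hz
    · simp at hz; omega
  | join i j h Φ ih =>
    rcases List.mem_append.1 hz with hz | hz
    · exact ih hz
    · simp at hz; omega

/-- The tables computed from the code of an expression hold the sizes and the best values of its
subexpressions. -/
theorem table_eq_best {N : ℕ} {T : ℕ → ℕ → ℕ} {C pre : ℕ → ℕ} {p : Fin n → Option (Fin ℓ)}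
    (hT : ∀ t < N, ∀ x ≤ (ℓ + 2) ^ (w + w), (C (3 * t) = 0 ∨ 0 < t) →
      (C (3 * t) = 0 → C (3 * t + 2) < n) → T t x =
      stepEntry ℓ w ((ℓ + 2) ^ (w + w)) pre T (C (3 * t)) (C (3 * t + 1)) (C (3 * t + 2)) t x)
    (hpre : ∀ v : Fin n, pre v = (p v).elim 0 fun a => (a : ℕ) + 1)
    (Φ : CWExpr (Fin n) w) (hΦ : Φ.leaves.Nodup) (t : ℕ) (ht : t + Φ.size ≤ N)
    (hC : ∀ i z, Φ.code[i]? = some z → C (3 * t + i) = z) :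
    (∀ x < (ℓ + 2) ^ (w + w), T (t + Φ.size - 1) x = Φ.best p (digit (ℓ + 2) x)) ∧
      T (t + Φ.size - 1) ((ℓ + 2) ^ (w + w)) = Φ.size := by
  -- The code of `Φ` occupies the operators from `t` on, so `Φ` itself has table `t + Φ.size - 1`.
  induction Φ generalizing t with
  | vertex i v =>
    have h0 := hC 0 0 rfl
    have h1 := hC 1 i rfl
    have h2 := hC 2 v rfl
    simp only [size, Nat.add_sub_cancel] at ht ⊢
    have key := fun x hx => hT t (by omega) x hx (.inl h0) fun _ => by omega
    simp only [add_zero] at h0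
    simp only [h0, h1, h2, stepEntry] at key
    refine ⟨fun x hx => ?_, ?_⟩
    · rw [key x hx.le, if_neg hx.ne, if_true, best_vertex, hpre]
    · rw [key _ le_rfl, if_pos rfl, if_true]
  | union Φ₁ Φ₂ ih₁ ih₂ =>
    obtain ⟨hd₁, hd₂, -⟩ := List.nodup_append'.1 hΦ
    have l₁ := Φ₁.length_code
    have l₂ := Φ₂.length_code
    have p₁ := Φ₁.size_pos
    have p₂ := Φ₂.size_pos
    simp only [size] at ht
    obtain ⟨b₁, s₁⟩ := ih₁ hd₁ t (by omega) fun i z hz => hC i z (by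
      have := (List.getElem?_eq_some_iff.1 hz).1
      rw [code, List.append_assoc, List.getElem?_append_left this, hz])
    obtain ⟨b₂, s₂⟩ := ih₂ hd₂ (t + Φ₁.size) (by omega) fun i z hz => by
      have := (List.getElem?_eq_some_iff.1 hz).1
      rw [mul_add, add_assoc]
      refine hC _ z ?_
      rw [code, List.append_assoc, List.getElem?_append_right (by omega),
        List.getElem?_append_left (by omega), ← hz]
      congr 1
      omega
    have hlast : ∀ i, C (3 * (t + Φ₁.size + Φ₂.size) + i) = ([1, 0, 0] : List ℕ).getD i 0 ∨
        3 ≤ i := fun i => by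
      by_cases hi : i < 3
      · left
        rw [show 3 * (t + Φ₁.size + Φ₂.size) + i = 3 * t + (3 * Φ₁.size + 3 * Φ₂.size + i) by ring]
        refine hC _ _ ?_
        rw [code, List.getElem?_append_right (by simp [l₁, l₂])]
        simp [l₁, l₂, hi]
      · exact .inr (by omega)
    have h0 := (hlast 0).resolve_right (by omega)
    have h1 := (hlast 1).resolve_right (by omega)
    have h2 := (hlast 2).resolve_right (by omega)
    have key := fun x hx => hT (t + Φ₁.size + Φ₂.size) (by omega) x hx (.inr (by omega))
      fun h => by simp [h] at h0
    simp at h0 h1 h2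
    -- The size of `Φ₂`, found in its table, leads back to the table of `Φ₁`.
    simp only [h0, h1, h2, stepEntry, s₂, show t + Φ₁.size + Φ₂.size - 1 - Φ₂.size =
      t + Φ₁.size - 1 by omega, s₁] at key
    simp only [size, ← add_assoc, Nat.add_sub_cancel]
    refine ⟨fun x hx => ?_, ?_⟩
    · rw [key x hx.le, if_neg hx.ne, if_neg one_ne_zero, if_true, best_union hΦ, b₁ x hx, b₂ x hx]
    · rw [key _ le_rfl, if_pos rfl, if_neg one_ne_zero, if_true, add_comm Φ₁.size]
  | relabel i j Φ ih =>
    have l := Φ.length_code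
    have ps := Φ.size_pos
    simp only [size] at ht
    obtain ⟨hb, hs⟩ := ih hΦ t (by omega) fun i z hz => hC i z (by
      have := (List.getElem?_eq_some_iff.1 hz).1
      rw [code, List.getElem?_append_left this, hz])
    have hlast : ∀ k < 3, C (3 * (t + Φ.size) + k) = [2, (i : ℕ), (j : ℕ)].getD k 0 := fun k hk => by
      rw [mul_add, add_assoc]
      refine hC _ _ ?_
      rw [code, List.getElem?_append_right (by omega)]
      simp [l, hk]
    have h0 := hlast 0 (by omega)
    have h1 := hlast 1 (by omega)
    have h2 := hlast 2 (by omega)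
    have key := fun x hx => hT (t + Φ.size) (by omega) x hx (.inr (by omega))
      fun h => by simp [h] at h0
    simp at h0 h1 h2
    simp only [h0, h1, h2, stepEntry, hs] at key
    simp only [size, ← add_assoc, Nat.add_sub_cancel]
    refine ⟨fun x hx => ?_, ?_⟩
    · have hlt := relabelState_lt (w := w) (i := i) (j := j) (digit_lt (ℓ := ℓ) x)
      rw [key x hx.le, if_neg hx.ne, if_neg two_ne_zero, if_neg (by omega), if_true, best_relabel,
        hb _ (ofDigits_lt hlt)]
      -- Coding and decoding preserve only the first `2 * w` values of the state, which is all that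
      -- `best` reads.
      exact best_congr fun k hk => digit_ofDigits hlt hk
    · rw [key _ le_rfl, if_pos rfl, if_neg two_ne_zero, if_neg (by omega)]
  | join i j hij Φ ih =>
    have l := Φ.length_code
    have ps := Φ.size_pos
    simp only [size] at ht
    obtain ⟨hb, hs⟩ := ih hΦ t (by omega) fun i z hz => hC i z (by
      have := (List.getElem?_eq_some_iff.1 hz).1
      rw [code, List.getElem?_append_left this, hz])
    have hlast : ∀ k < 3, C (3 * (t + Φ.size) + k) = [3, (i : ℕ), (j : ℕ)].getD k 0 := fun k hk => by
      rw [mul_add, add_assoc]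
      refine hC _ _ ?_
      rw [code, List.getElem?_append_right (by omega)]
      simp [l, hk]
    have h0 := hlast 0 (by omega)
    have h1 := hlast 1 (by omega)
    have h2 := hlast 2 (by omega)
    have key := fun x hx => hT (t + Φ.size) (by omega) x hx (.inr (by omega))
      fun h => by simp [h] at h0
    simp at h0 h1 h2
    simp only [h0, h1, h2, stepEntry, hs] at key
    simp only [size, ← add_assoc, Nat.add_sub_cancel]
    refine ⟨fun x hx => ?_, ?_⟩
    · rw [key x hx.le, if_neg hx.ne, if_neg three_ne_zero, if_neg (by omega), if_neg (by omega),
        best_join (Φ := Φ) i j hij hΦ]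
      refine joinEntry_congr (digit_lt x) fun τ hτ => ?_
      rw [hb _ (ofDigits_lt hτ)]
      exact best_congr fun k hk => digit_ofDigits hτ hk
    · rw [key _ le_rfl, if_pos rfl, if_neg three_ne_zero, if_neg (by omega)]

end CWExpr

/-! ### Layout of the input in memory -/

namespace MHVInput

variable (I : MHVInput)

/-- The initial memory. -/
noncomputable def memory : ℕ → ℕ := (Store.init I.encode).mem

theorem getD_length_add {l l₁ l₂ : List ℕ} {a i z : ℕ} (hl : l = l₁ ++ l₂) (ha : l₁.length = a)
    (hz : l₂[i]? = some z) : l.getD (a + i) 0 = z := by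
  subst hl ha
  rw [List.getD_append_right _ _ _ _ (by omega), Nat.add_sub_cancel_left, List.getD_eq_getElem?_getD,
    hz, Option.getD_some]

theorem memory_preStart (v : Fin I.n) :
    I.memory (I.n * I.n + 5 + v) = (I.p v).elim 0 fun a => (a : ℕ) + 1 := by
  refine getD_length_add (List.append_assoc _ _ _) ?_ ?_
  · simp [List.length_flatMap]
  · rw [List.getElem?_append_left (by simp)]
    simp

theorem memory_codeStart {i z : ℕ} (hz : I.Ψ.code[i]? = some z) :
    I.memory (codeStart I.n + i) = z :=
  getD_length_add rfl (by
    simp [codeStart, List.length_flatMap]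
    ring) hz

/-- A single product dominates every bound in `Setting`: the number of entries of a table, times the
sum of the other parameters. -/
theorem setting_memory {X : ℕ} {m : ℕ → ℕ} (hm : ∀ i < 5, m i = I.memory i)
    (hX : ((I.ℓ + 2) ^ (I.w + I.w) + 1) * (I.w + I.w + I.n + 3 + I.Ψ.size + I.ℓ) ≤ X) :
    Setting X I.ℓ I.k I.n I.w I.Ψ.size m := by
  have h1 : I.w + I.w + I.n + 3 + I.Ψ.size + I.ℓ ≤ X :=
    (Nat.le_mul_of_pos_left _ (Nat.succ_pos _)).trans hX
  have h2 : (I.ℓ + 2) ^ (I.w + I.w) ≤ X :=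
    (Nat.le_succ _).trans ((Nat.le_mul_of_pos_right _ (by omega)).trans hX)
  have h3 := (Nat.mul_le_mul_left ((I.ℓ + 2) ^ (I.w + I.w) + 1)
    (show I.Ψ.size ≤ I.w + I.w + I.n + 3 + I.Ψ.size + I.ℓ by omega)).trans hX
  constructor
  all_goals first
    | omega
    | rw [hm _ (by omega)]; rfl

end MHVInput

/-! ### The program and its correctness -/

/-- The state of the whole expression: any colors, and no neighbours to come. -/
def rootState (ℓ w k : ℕ) : ℕ := if k < w then ℓ + 1 else 0

namespace Tm

def rootState (k : Tm) : Tm := ite (sub (cell 3) k) (add (cell 0) (lit 1)) (lit 0)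

def answer : Tm :=
  ite (sub (add (cell 1) (lit 1)) (tableEntry (sub (cell 4) (lit 1)) (ofDigits rootState)))
    (lit 0) (lit 1)

end Tm

theorem rootState_lt {ℓ w : ℕ} (k : ℕ) : rootState ℓ w k < ℓ + 2 := by
  unfold rootState; split_ifs <;> omega

theorem Setting.den_answer {X ℓ k n w N : ℕ} {m : ℕ → ℕ} {Γ : Ctx} (h : Setting X ℓ k n w N m) :
    Den X m Γ .answer (if k + 1 ≤ tableEntry (tableStart n N) ((ℓ + 2) ^ (w + w)) m (N - 1)
      (ofDigits (ℓ + 2) (w + w) (rootState ℓ w)) then 1 else 0) := by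
  have hX := h.two_le
  have hroot : DenFun X m Γ .rootState (rootState ℓ w) := fun Γ' _ t a _ hta =>
    .ite hX (.sub hX h.den_width hta)
      (fun ha => (Den.add hX h.den_colors (h.den_lit 1)).of_eq (if_pos (by omega)).symm)
      fun ha => (h.den_lit 0).of_eq (if_neg (by omega)).symm
  have htab := h.den_tableEntry (.sub hX h.den_size (h.den_lit 1))
    (h.den_ofDigits hroot rootState_lt) (by have := h.size_le; omega)
  exact .ite hX (.sub hX (.add hX ((h.den_cell 1).of_eq h.cell_one) (h.den_lit 1)) htab)
    (fun ha => (h.den_lit 0).of_eq (if_neg (by omega)).symm)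
    fun ha => (h.den_lit 1).of_eq (if_pos (by omega)).symm

/-- The program for Maximum Happy Vertices. -/
def solveMHV : Prog :=
  -- Without colors the answer is no; the tables would still have `2 ^ (2 * w)` states, too many for
  -- the time bound.
  .seq (Tm.cell 0 0) <| .cond 0
    (.seq (fill (.mul (.add .states (.lit 1)) (.cell 4)) .tableStart .entry) (Tm.answer 0))
    (.instr (.const 0 0))

namespace MHVInput

variable (I : MHVInput)

/-- The memory after the first `y` table cells have been filled. -/
noncomputable def filled (y : ℕ) : ℕ → ℕ :=
  fillMem (tableStart I.n I.Ψ.size) (entry I.ℓ I.n I.w I.Ψ.size) I.memory y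

theorem filled_of_lt {y a : ℕ} (ha : a < tableStart I.n I.Ψ.size) : I.filled y a = I.memory a :=
  fillMem_of_lt _ _ _ (Nat.zero_le y) (by omega)

theorem filled_codeStart {y i z : ℕ} (hz : I.Ψ.code[i]? = some z) :
    I.filled y (codeStart I.n + i) = z := by
  have := (List.getElem?_eq_some_iff.1 hz).1
  rw [I.Ψ.length_code] at this
  rw [filled_of_lt _ (by unfold tableStart; omega), I.memory_codeStart hz]

theorem filled_codeStart_le {y i : ℕ} (hi : i < 3 * I.Ψ.size) :
    I.filled y (codeStart I.n + i) ≤ I.w + I.n + 3 := by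
  rw [← I.Ψ.length_code] at hi
  rw [I.filled_codeStart (List.getElem?_eq_getElem hi)]
  exact CWExpr.le_of_mem_code (List.getElem_mem hi)

/-- A cell was computed from the memory of its own round. The recurrence holds in the final memory
too, because the input and the earlier tables never change afterwards. -/
theorem filled_tableEntry {t x : ℕ} (ht : t < I.Ψ.size) (hx : x ≤ (I.ℓ + 2) ^ (I.w + I.w))
    (h₀ : I.filled (((I.ℓ + 2) ^ (I.w + I.w) + 1) * I.Ψ.size) (codeStart I.n + 3 * t) = 0 ∨ 0 < t)
    (h₂ : I.filled (((I.ℓ + 2) ^ (I.w + I.w) + 1) * I.Ψ.size) (codeStart I.n + 3 * t) = 0 →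
      I.filled (((I.ℓ + 2) ^ (I.w + I.w) + 1) * I.Ψ.size) (codeStart I.n + (3 * t + 2)) < I.n) :
    let M := (I.ℓ + 2) ^ (I.w + I.w)
    let m := I.filled ((M + 1) * I.Ψ.size)
    tableEntry (tableStart I.n I.Ψ.size) M m t x =
      stepEntry I.ℓ I.w M (fun v => m (I.n * I.n + 5 + v))
        (tableEntry (tableStart I.n I.Ψ.size) M m) (m (codeStart I.n + 3 * t))
        (m (codeStart I.n + (3 * t + 1))) (m (codeStart I.n + (3 * t + 2))) t x := by
  intro M m
  have hy : (M + 1) * t + x < (M + 1) * I.Ψ.size := by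
    have := Nat.mul_le_mul_left (M + 1) (Nat.succ_le_of_lt ht)
    rw [Nat.mul_succ] at this
    omega
  have hdiv : ((M + 1) * t + x) / (M + 1) = t := by
    rw [Nat.mul_add_div (Nat.succ_pos M), Nat.div_eq_of_lt (by omega), add_zero]
  have hmod : ((M + 1) * t + x) % (M + 1) = x := by
    rw [Nat.mul_add_mod, Nat.mod_eq_of_lt (by omega)]
  have hlow : ∀ a < tableStart I.n I.Ψ.size, I.filled ((M + 1) * t + x) a = m a := fun a ha => by
    exact (I.filled_of_lt ha).trans (I.filled_of_lt ha).symm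
  have hcode : ∀ i < 3, I.filled ((M + 1) * t + x) (codeStart I.n + (t + (t + t)) + i) =
      m (codeStart I.n + (3 * t + i)) := fun i hi => by
    rw [hlow _ (by unfold tableStart; omega)]
    congr 1
    ring
  have h0 := hcode 0 (by omega)
  rw [add_zero, add_zero] at h0
  refine (fillMem_add _ _ _ hy).trans ?_
  change stepEntry I.ℓ I.w M (fun v => I.filled ((M + 1) * t + x) (I.n * I.n + 5 + v))
    (tableEntry (tableStart I.n I.Ψ.size) M (I.filled ((M + 1) * t + x)))
    (I.filled _ (codeStart I.n + (((M + 1) * t + x) / (M + 1) + _)))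
    (I.filled _ (codeStart I.n + (((M + 1) * t + x) / (M + 1) + _) + 1))
    (I.filled _ (codeStart I.n + (((M + 1) * t + x) / (M + 1) + _) + 2))
    (((M + 1) * t + x) / (M + 1)) (((M + 1) * t + x) % (M + 1)) = _
  rw [hdiv, hmod, h0, hcode 1 (by omega), hcode 2 (by omega)]
  refine stepEntry_congr h₀ hx (fun h => hlow _ ?_) fun t' ht' x' hx' => ?_
  · have : m (codeStart I.n + (3 * t + 2)) < I.n := h₂ h
    have hts : tableStart I.n I.Ψ.size =
      I.n * I.n + 5 + I.n + (I.Ψ.size + (I.Ψ.size + I.Ψ.size)) := rfl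
    omega
  · refine (fillMem_of_lt _ _ _ hy.le ?_).symm
    have := Nat.mul_le_mul_left (M + 1) (Nat.succ_le_of_lt ht')
    rw [Nat.mul_succ] at this
    omega

/-- The whole expression is the subexpression starting at operator `0`, so its best value at the
root state stands in the last table. -/
theorem mhv_iff_filled :
    MHV I.G I.p I.k ↔ I.k + 1 ≤ tableEntry (tableStart I.n I.Ψ.size) ((I.ℓ + 2) ^ (I.w + I.w))
      (I.filled (((I.ℓ + 2) ^ (I.w + I.w) + 1) * I.Ψ.size)) (I.Ψ.size - 1)
      (ofDigits (I.ℓ + 2) (I.w + I.w) (rootState I.ℓ I.w)) := by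
  have := (I.Ψ.table_eq_best (N := I.Ψ.size) (T := tableEntry (tableStart I.n I.Ψ.size)
      ((I.ℓ + 2) ^ (I.w + I.w)) (I.filled (((I.ℓ + 2) ^ (I.w + I.w) + 1) * I.Ψ.size)))
    (C := fun i => I.filled (((I.ℓ + 2) ^ (I.w + I.w) + 1) * I.Ψ.size) (codeStart I.n + i))
    (p := I.p) (fun t ht x hx h₀ h₂ => I.filled_tableEntry ht hx h₀ h₂)
    (fun v => by
      rw [I.filled_of_lt (by simp only [tableStart, codeStart]; omega), I.memory_preStart])
    I.expresses.nodup 0 (by omega) fun i z hz => by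
      simpa only [mul_zero, zero_add] using I.filled_codeStart hz).1
  rw [zero_add] at this
  rw [this _ (ofDigits_lt rootState_lt), CWExpr.best_root I.expresses]
  exact iff_of_eq <| congrArg _ <| CWExpr.best_congr fun k hk =>
    (digit_ofDigits rootState_lt hk).symm

theorem solveMHV_decidesWithin {X : ℕ}
    (hX : I.ℓ = 0 ∧ 2 ≤ X ∨
      ((I.ℓ + 2) ^ (I.w + I.w) + 1) * (I.w + I.w + I.n + 3 + I.Ψ.size + I.ℓ) ≤ X) :
    solveMHV.DecidesWithin I.encode (MHV I.G I.p I.k) (X ^ solveMHV.weight) := by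
  have hX2 : 2 ≤ X := hX.elim And.right fun h => (I.setting_memory (fun _ _ => rfl) h).two_le
  suffices ∃ s, Runs X solveMHV (Store.init I.encode) s ∧
      (MHV I.G I.p I.k → s.reg 0 = 1) ∧ (¬ MHV I.G I.p I.k → s.reg 0 = 0) by
    obtain ⟨s, ⟨t, e, ht⟩, h⟩ := this
    exact ⟨s, t, e, ht, h⟩
  obtain ⟨s₁, e₁, m₁, -, v₁⟩ := (Den.load hX2 (Den.lit hX2 0) : Den X I.memory ⟨0, fun _ => 0⟩
    (.cell 0) _) 0 le_rfl (Store.init I.encode) rfl fun _ _ => rfl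
  have v₁ : s₁.reg 0 = I.ℓ := v₁
  by_cases hℓ : I.ℓ = 0
  · refine ⟨_, e₁.seq hX2 (.cond_false hX2 (v₁.trans hℓ) (.instr hX2 _ s₁)), ?_, fun _ => by
      simp [Instr.apply]⟩
    -- Every expression creates a vertex, and it cannot be colored.
    rintro ⟨c, -⟩
    obtain ⟨v, -⟩ := List.exists_mem_of_ne_nil _ I.Ψ.leaves_ne_nil
    exact absurd (c v).2 (by omega)
  · have hX := hX.resolve_left (by omega)
    have hset : ∀ y, Setting X I.ℓ I.k I.n I.w I.Ψ.size (I.filled y) := fun y =>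
      I.setting_memory (fun i hi => I.filled_of_lt (by simp only [tableStart, codeStart]; omega)) hX
    have hset₀ := hset 0
    have hmem : s₁.mem = I.filled 0 := m₁
    obtain ⟨s₂, e₂, m₂⟩ := Runs.fill (X := X) (s := s₁)
      (n := .mul (.add .states (.lit 1)) (.cell 4)) (base := .tableStart) (f := .entry)
      (N := ((I.ℓ + 2) ^ (I.w + I.w) + 1) * I.Ψ.size) (b := tableStart I.n I.Ψ.size)
      (F := entry I.ℓ I.n I.w I.Ψ.size) hX2
      (fun Γ => hmem ▸ .mul hX2 (.add hX2 hset₀.den_states (hset₀.den_lit 1)) hset₀.den_size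
        hset₀.size_le)
      (fun Γ => hmem ▸ hset₀.den_tableStart) hset₀.tables_le
      (fun y hy Γ t ht => by
        rw [m₁] at ht ⊢
        exact (hset y).den_entry ht hy fun i hi => I.filled_codeStart_le (by omega))
    rw [m₁] at m₂
    obtain ⟨s₃, e₃, -, -, v₃⟩ := (hset _).den_answer (Γ := ⟨0, fun _ => 0⟩) 0 le_rfl s₂ m₂
      fun r hr => absurd hr (Nat.not_lt_zero r)
    refine ⟨s₃, e₁.seq hX2 (.cond_true hX2 (by rwa [v₁]) (e₂.seq hX2 e₃)), fun h => ?_, fun h => ?_⟩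
    · rw [v₃, if_pos (I.mhv_iff_filled.1 h)]
    · rw [v₃, if_neg (I.mhv_iff_filled.not.1 h)]

/-! ### Running time -/

/-- The running time in terms of the parameters. -/
theorem exists_solveMHV_decidesWithin : ∃ C : ℕ, ∀ I : MHVInput,
    solveMHV.DecidesWithin I.encode (MHV I.G I.p I.k)
      (C * (I.ℓ + 1) ^ (C * I.w) * (I.n + I.Ψ.size) ^ C) := by
  generalize hs : solveMHV.weight = s
  -- The `s`-th power of `16 * A ^ (5 * w) * Y` has factor `16 ^ s` and exponents `5 * s * w` and
  -- `s`; the sum dominates `16 ^ s`, `5 * s` and `s`.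
  refine ⟨16 ^ s + 5 * s, fun I => ?_⟩
  have hw := I.Ψ.width_pos
  have hN := I.Ψ.size_pos
  set A := I.ℓ + 1 with hA
  set Y := I.n + I.Ψ.size with hY
  have key : ∃ X, (I.ℓ = 0 ∧ 2 ≤ X ∨
      ((I.ℓ + 2) ^ (I.w + I.w) + 1) * (I.w + I.w + I.n + 3 + I.Ψ.size + I.ℓ) ≤ X) ∧
      X ≤ 16 * A ^ (5 * I.w) * Y := by
    have hY1 : 1 ≤ Y := by omega
    rcases Nat.eq_zero_or_pos I.ℓ with hℓ | hℓ
    · refine ⟨16 * A ^ (5 * I.w) * Y, .inl ⟨hℓ, ?_⟩, le_rfl⟩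
      have : 1 ≤ A ^ (5 * I.w) := Nat.one_le_pow _ _ (by omega)
      nlinarith
    · refine ⟨_, .inr le_rfl, ?_⟩
      -- Since `ℓ` is positive, `ℓ + 2 ≤ (ℓ + 1) ^ 2`.
      have h1 : (I.ℓ + 2) ^ (I.w + I.w) ≤ A ^ (4 * I.w) := by
        rw [show 4 * I.w = 2 * (I.w + I.w) by ring, pow_mul]
        exact Nat.pow_le_pow_left (by rw [hA]; nlinarith) _
      have h2 : I.w < A ^ I.w := Nat.lt_pow_self (by omega)
      have h3 : A ≤ A ^ I.w := Nat.le_self_pow (by omega) _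
      have h4 : 1 ≤ A ^ (4 * I.w) := Nat.one_le_pow _ _ (by omega)
      have h5 : I.w + I.w + I.n + 3 + I.Ψ.size + I.ℓ ≤ 8 * A ^ I.w * Y := by
        have : A ^ I.w ≤ A ^ I.w * Y := Nat.le_mul_of_pos_right _ hY1
        have : Y ≤ A ^ I.w * Y := Nat.le_mul_of_pos_left _ (by omega)
        have : 8 * A ^ I.w * Y = 8 * (A ^ I.w * Y) := by ring
        omega
      calc _ ≤ (2 * A ^ (4 * I.w)) * (8 * A ^ I.w * Y) := Nat.mul_le_mul (by omega) h5
        _ = 16 * A ^ (5 * I.w) * Y := by rw [show 5 * I.w = 4 * I.w + I.w by ring, pow_add]; ring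
  obtain ⟨X, hX, hXb⟩ := key
  obtain ⟨s', t, e, ht, h⟩ := I.solveMHV_decidesWithin hX
  refine ⟨s', t, e, ht.trans ?_, h⟩
  rw [hs]
  calc X ^ s ≤ (16 * A ^ (5 * I.w) * Y) ^ s := Nat.pow_le_pow_left hXb s
    _ = 16 ^ s * A ^ (5 * s * I.w) * Y ^ s := by
      rw [mul_pow, mul_pow, ← pow_mul, mul_right_comm 5]
    _ ≤ _ := by
      generalize 16 ^ s = K
      gcongr <;> omega

end MHVInput

theorem mainTheorem1 :
    ∃ P : Prog,
      (∃ C : ℕ, ∀ I : MHVInput,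
        P.DecidesWithin I.encode (MHV I.G I.p I.k)
          (C * (I.ℓ + 1) ^ (C * I.w) * (I.n + I.Ψ.size) ^ C)) ∧
      (∃ (f : ℕ → ℕ) (d : ℕ), Computable f ∧ ∀ I : MHVInput,
        P.DecidesWithin I.encode (MHV I.G I.p I.k)
          (f (I.w + I.ℓ) * (I.n + I.Ψ.size) ^ d)) := by
  obtain ⟨C, hC⟩ := MHVInput.exists_solveMHV_decidesWithin
  have hpow : Primrec₂ fun a b : ℕ => a ^ b := Primrec₂.unpaired'.1 Nat.Primrec.pow
  -- Replacing both `ℓ` and `w` by `w + ℓ` in the first bound gives `f`.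
  refine ⟨solveMHV, ⟨C, hC⟩, fun x => C * (x + 1) ^ (C * x), C, ?_, fun I => ?_⟩
  · exact (Primrec.nat_mul.comp (.const C)
      (hpow.comp Primrec.succ (Primrec.nat_mul.comp (.const C) .id))).to_comp
  · obtain ⟨s, t, e, ht, h⟩ := hC I
    refine ⟨s, t, e, ht.trans ?_, h⟩
    have : (I.ℓ + 1) ^ (C * I.w) ≤ (I.w + I.ℓ + 1) ^ (C * (I.w + I.ℓ)) :=
      (Nat.pow_le_pow_left (by omega) _).trans
        (Nat.pow_le_pow_right (by omega) (Nat.mul_le_mul_left _ (by omega)))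
    exact Nat.mul_le_mul_right _ (Nat.mul_le_mul_left C this)
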